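/- Let $\mathbf{F}_q$ be a finite field with Frobenius map $\varphi$. Let $P$ be a rational point of $\mathbf{P}^2$, let $l, l^{\varphi}$ be a pair of distinct conjugate lines defined over $\mathbf{F}_{q^2}$ and meeting at $P$, let $D = l \cup l^{\varphi}$, and let $R$ be a closed point of degree $4$ of $D$ (so that $R$ splits over $\mathbf{F}_{q^4}$ into four distinct conjugate points $r, r^{\varphi}, r^{\varphi^2}, r^{\varphi^3}$). Let $\pi : Y \to \mathbf{P}^2$ be the blow-up of $\mathbf{P}^2$ at $P$ and $R$, with exceptional divisors $E$ above $P$ and $F$ above $R$. Let $\Lambda_4$ be the linear system of plane quartics $B$ over $\mathbf{F}_q$ (zero divisors of nonzero quartic forms over $\mathbf{F}_q$) containing $R$ with multiplicity at least $1$ and $P$ with multiplicity at least $2$, and let $\pi^{\star}\Lambda_4 - 2E - F = \{\pi^{\star}B - 2E - F : B \in \Lambda_4\}$ be the corresponding linear system of curves on $Y$. Then every curve $C$ in the linear system $\pi^{\star}\Lambda_4 - 2E - F$ satisfies $$\sharp C(\mathbf{F}_q) \leq 3q+3,$$ and, if $q \geq 3$, this bound is reached: for every such choice of $P, l, R$ there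 is a curve $C$ in $\pi^{\star}\Lambda_4 - 2E - F$ with $\sharp C(\mathbf{F}_q) = 3q+3$. -/

import Mathlib

open scoped LinearAlgebra.Projectivization

noncomputable section

namespace PlaneBlowup

variable (k : Type*) [Field k] [Fintype k] {K : Type*} [Field K] [Algebra k K]

variable (K) in
/-- The `q`-power Frobenius `x ↦ x ^ q` of `K`, where `q` is the cardinality of `k`. -/
def frob : K →+* K := (FiniteField.frobeniusAlgHom k K : K →+* K)

variable (K) in
/-- Frobenius acting coordinatewise on `K ^ 3`. -/
def frobVec : (Fin 3 → K) →ₛₗ[frob k K] (Fin 3 → K) where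
  toFun v i := frob k K (v i)
  map_add' v w := by ext i; simp
  map_smul' c v := by ext i; simp

theorem frobVec_injective : Function.Injective (frobVec k K) := by
  intro v w h
  ext i
  exact (frob k K).injective (congrFun h i)

/-- Frobenius acting on the projective plane over `K`, and also (through the coefficients of an
equation) on its lines. A line is represented by the class of the coefficients of its equation, so
that the point `x` lies on the line `m` iff `Projectivization.orthogonal x m`. -/
def frobPlane : ℙ K (Fin 3 → K) → ℙ K (Fin 3 → K) :=
  Projectivization.map (frobVec k K) (frobVec_injective k)

/-- The geometric points of the blow-up of the projective plane at a finite set `Z` of points: it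
is the fibre product over the plane of the blow-ups at each `a ∈ Z`, and the blow-up at `a` is the
incidence variety of the pairs `(x, m)` where `m` is a line through `a` and `x` is a point of `m`.
The blow-up map sends a point to `pt`, and the exceptional curve over `a` is the locus `pt = a`. -/
@[ext] structure Blowup (Z : Set (ℙ K (Fin 3 → K))) where
  pt : ℙ K (Fin 3 → K)
  line : Z → ℙ K (Fin 3 → K)
  center_mem : ∀ a : Z, Projectivization.orthogonal (a : ℙ K (Fin 3 → K)) (line a)
  pt_mem : ∀ a : Z, Projectivization.orthogonal pt (line a)

variable {Z : Set (ℙ K (Fin 3 → K))}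

/-- A geometric point of the blow-up is rational over `k` when it is fixed by Frobenius. When `Z` is
stable under Frobenius, Frobenius sends `(x, (m a)_a)` to the point over `φ x` whose line through
`φ a` is `φ (m a)`. -/
def Blowup.IsRational (y : Blowup Z) : Prop :=
  frobPlane k y.pt = y.pt ∧
    ∀ a b : Z, (b : ℙ K (Fin 3 → K)) = frobPlane k (a : ℙ K (Fin 3 → K)) →
      y.line b = frobPlane k (y.line a)

/-- The plane curve `f = 0` has multiplicity at least `n` at the point `a`: the form `f` lies in the
`n`-th power of the maximal ideal of a representative of `a` in the affine cone. -/
def HasMultAtLeast (f : MvPolynomial (Fin 3) K) (n : ℕ) (a : ℙ K (Fin 3 → K)) : Prop :=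
  f ∈ (Ideal.span (Set.range fun i : Fin 3 =>
    (MvPolynomial.X i - MvPolynomial.C (a.rep i) : MvPolynomial (Fin 3) K))) ^ n

/-- The pullback `f (α a + β v)` of the form `f` to the homogeneous coordinates `(α, β, v)` of the
blow-up at `a`, in which `(α, β, v)` with `a, v` independent and `(α, β) ≠ 0` stands for the point
`α a + β v` together with the line spanned by `a` and `v`. The variables `α`, `β`, `v i` are
`X (inl 0)`, `X (inl 1)`, `X (inr i)`, and `β = 0` is an equation of the exceptional curve. -/
def pullback (a : ℙ K (Fin 3 → K)) (f : MvPolynomial (Fin 3) K) :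
    MvPolynomial (Fin 2 ⊕ Fin 3) K :=
  MvPolynomial.aeval (fun i : Fin 3 =>
    MvPolynomial.X (Sum.inl 0) * MvPolynomial.C (a.rep i) +
      MvPolynomial.X (Sum.inl 1) * MvPolynomial.X (Sum.inr i)) f

/-- `c = (α, β, v)` are homogeneous coordinates, with respect to the centre `a`, of the point `x`
on the line `m` through `a`. -/
def IsCoord (a x m : ℙ K (Fin 3 → K)) (c : Fin 2 ⊕ Fin 3 → K) : Prop :=
  LinearIndependent K ![a.rep, fun i => c (Sum.inr i)] ∧
  (fun i => c (Sum.inr i)) ⬝ᵥ m.rep = 0 ∧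
  ∃ h : (c (Sum.inl 0) • a.rep + c (Sum.inl 1) • fun i => c (Sum.inr i)) ≠ 0,
    Projectivization.mk K _ h = x

/-- The set of geometric points of the divisor `π^* B - ∑ a ∈ Z, μ a • E a` on the blow-up
`π` of the plane at `Z`, for the plane curve `B : f = 0` of multiplicity at least `μ a` at every
`a ∈ Z`. Away from the exceptional curves its equation is that of `B`; at the points of the
exceptional curve `E a` it is `G = 0`, where `f (α a + β v) = β ^ μ a * G`. -/
def residualCurve (Z : Set (ℙ K (Fin 3 → K))) (μ : ℙ K (Fin 3 → K) → ℕ)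
    (f : MvPolynomial (Fin 3) K) : Set (Blowup Z) :=
  {y | (y.pt ∉ Z ∧ MvPolynomial.eval y.pt.rep f = 0) ∨
    ∃ a : Z, y.pt = a ∧ ∃ G : MvPolynomial (Fin 2 ⊕ Fin 3) K,
      pullback (a : ℙ K (Fin 3 → K)) f = MvPolynomial.X (Sum.inl 1) ^ μ a * G ∧
      ∃ c, IsCoord (a : ℙ K (Fin 3 → K)) y.pt (y.line a) c ∧ MvPolynomial.eval c G = 0}

/-- The linear system of plane curves of degree `d` over `k` with multiplicity at least `μ a` at
each `a ∈ Z`, given by the equations of its members. -/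
def planeSystem (d : ℕ) (Z : Set (ℙ K (Fin 3 → K))) (μ : ℙ K (Fin 3 → K) → ℕ) :
    Set (MvPolynomial (Fin 3) k) :=
  {f | f ≠ 0 ∧ f.IsHomogeneous d ∧
    ∀ a ∈ Z, HasMultAtLeast (MvPolynomial.map (algebraMap k K) f) (μ a) a}

/-- The linear system `π^* Λ - ∑ a ∈ Z, μ a • E a` on the blow-up, where `Λ` is the linear system of
plane curves of degree `d` over `k` with multiplicity at least `μ a` at each `a ∈ Z`. -/
def blowupSystem (d : ℕ) (Z : Set (ℙ K (Fin 3 → K))) (μ : ℙ K (Fin 3 → K) → ℕ) :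
    Set (Set (Blowup Z)) :=
  {C | ∃ f ∈ planeSystem k d Z μ,
    C = residualCurve Z μ (MvPolynomial.map (algebraMap k K) f)}

/-- The points of a curve on the blow-up that are rational over `k`. -/
def rationalPoints (C : Set (Blowup Z)) : Set (Blowup Z) :=
  {y | y ∈ C ∧ y.IsRational k}

/-- The geometric points blown up to get the surface `Y`: the point `P` and the geometric points
`r, φ r, φ² r, …` of the closed point `R` that `r` lies over. -/
def centers (P r : ℙ K (Fin 3 → K)) : Set (ℙ K (Fin 3 → K)) :=
  insert P (Set.range fun i : ℕ => (frobPlane k)^[i] r)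

open Classical in
/-- The multiplicities imposed: `2` at `P` and `1` at the other points. -/
def mults (P : ℙ K (Fin 3 → K)) (a : ℙ K (Fin 3 → K)) : ℕ := if a = P then 2 else 1

end PlaneBlowup

end

noncomputable section

namespace PlaneBlowup

/-! Write q for the cardinality of k and φ for Frobenius. No centre other than P is rational, so the
rational points of Y are those of the blow-up of the plane at P, which is ruled over the line of
directions at P. They correspond to pairs (d, w), with d one of the q + 1 rational lines through P
and w a rational point of that line, `none` standing for the point on E. With P = (1, 0, 0), a
quartic with a double point at P reads z² A(s, t) + z B(s, t) + C(s, t), and the residual curve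
meets the fibre d in the zeros of the binary quadratic form with coefficients A(d), B(d), C(d)
(`exists_expansion_of_mult_two`, `eq_zero_of_mem_residualCurve`).

Upper bound. If at most one fibre lies in the curve, each of the q others has at most 2 points, and
(q + 1) + 2q suffices. Otherwise the quartic consists of two rational lines through P and a conic
through R (`encard_le_of_two_fibers`). If the conic misses P, its points above the slope θ of a
conjugate line are r and φ² r, so it contains no rational line and has at most q + 1 points
(`card_conic_le`). If it passes through P, conjugation by φ² shows that it is a binary form in s, t
vanishing at θ; it has no rational zero, and outside the two fibres only the points of E remain.
Both cases give at most 3(q + 1).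

Sharpness. Apart from D, the conics through R form a family of q members which partition the q(q +
1) rational points other than P; each has at most q + 1 of them, hence exactly q + 1. A rational
line through P has no rational point in common with about half of the members. Summed over the lines
this gives at least (q² - 1)/2 pairs, more than q once q ≥ 3, so some member is missed by two lines
(`exists_conic_through`). That conic and those two lines have 3(q + 1) rational points on Y. -/

theorem eq_of_orthogonal {K : Type*} [Field K] {x y m n : ℙ K (Fin 3 → K)} (hxy : x ≠ y)
    (hxm : x.orthogonal m) (hym : y.orthogonal m) (hxn : x.orthogonal n) (hyn : y.orthogonal n) : m = n := by
  have key : ∀ m : ℙ K (Fin 3 → K), x.orthogonal m → y.orthogonal m →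
      m = (open Classical in x.cross y) := by
    classical
    intro m hxm hym
    induction x with | h v hv =>
    induction y with | h w hw =>
    induction m with | h u hu =>
    rw [Projectivization.orthogonal_mk] at hxm hym
    rw [Projectivization.cross_mk_of_ne hv hw hxy,
      Projectivization.mk_eq_mk_iff_crossProduct_eq_zero, cross_cross_eq_smul_sub_smul']
    rw [dotProduct_comm] at hxm
    rw [dotProduct_comm v, hxm, dotProduct_comm, hym]
    simp
  rw [key m hxm hym, key n hxn hyn]

/-! ### Descent from K to k and to the quadratic extension -/

section Frobenius

variable {k : Type*} [Field k] [Fintype k] {K : Type*} [Field K] [Algebra k K]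

theorem frob_apply (x : K) : frob k K x = x ^ Fintype.card k := rfl

@[simp] theorem frob_algebraMap (a : k) : frob k K (algebraMap k K a) = algebraMap k K a :=
  (FiniteField.frobeniusAlgHom k K).commutes a

/-- A fixed element is a root of X^q - X, which over k is already the product of the X - a. -/
theorem exists_algebraMap_of_frob_eq {x : K} (h : frob k K x = x) :
    ∃ a : k, algebraMap k K a = x := by
  have h1 : ∏ a : k, (Polynomial.X - Polynomial.C a) =
      (Polynomial.X ^ Fintype.card k - Polynomial.X : Polynomial k) := by
    have hq := Fintype.one_lt_card (α := k)
    have hroots := FiniteField.roots_X_pow_card_sub_X k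
    have hdeg := FiniteField.X_pow_card_sub_X_natDegree_eq k hq
    have := Polynomial.prod_multiset_X_sub_C_of_monic_of_roots_card_eq
      (p := (Polynomial.X ^ Fintype.card k - Polynomial.X : Polynomial k))
      (Polynomial.monic_X_pow_sub (by simpa using hq)) (by rw [hroots, hdeg]; rfl)
    rwa [hroots] at this
  have h2 := congrArg (Polynomial.aeval x) h1
  rw [map_prod] at h2
  simp only [map_sub, Polynomial.aeval_X, Polynomial.aeval_C, map_pow] at h2
  rw [← frob_apply, h, sub_self, Finset.prod_eq_zero_iff] at h2
  obtain ⟨a, -, ha⟩ := h2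
  exact ⟨a, (sub_eq_zero.1 ha).symm⟩

/-- The elements fixed by the square of Frobenius form the plane spanned by `θ` and `1`. -/
theorem exists_eq_mul_add_of_frob_frob_eq {θ : K} (hθ : frob k K θ ≠ θ)
    (hθ' : frob k K (frob k K θ) = θ) {x : K} (hx : frob k K (frob k K x) = x) :
    ∃ a b : k, x = algebraMap k K a * θ + algebraMap k K b := by
  have h0 : θ - frob k K θ ≠ 0 := sub_ne_zero.2 hθ.symm
  -- This is the value of a obtained by solving x = aθ + b together with its conjugate. Frobenius
  -- changes the sign of both differences.
  obtain ⟨a, ha⟩ := exists_algebraMap_of_frob_eq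
    (k := k) (x := (x - frob k K x) / (θ - frob k K θ)) (by
      rw [map_div₀, map_sub, map_sub, hθ', hx, ← neg_sub x, ← neg_sub θ, neg_div_neg_eq])
  rw [eq_div_iff h0] at ha
  obtain ⟨b, hb⟩ := exists_algebraMap_of_frob_eq
    (k := k) (x := x - algebraMap k K a * θ) (by
      rw [map_sub, map_mul, frob_algebraMap]
      linear_combination ha)
  exact ⟨a, b, by rw [hb]; ring⟩

theorem eq_zero_of_mul_add_eq_zero {θ : K} (hθ : frob k K θ ≠ θ) {a b : k}
    (h : algebraMap k K a * θ + algebraMap k K b = 0) : a = 0 ∧ b = 0 := by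
  have ha : a = 0 := by
    have h' := congrArg (frob k K) h
    simp only [map_add, map_mul, frob_algebraMap, map_zero] at h'
    have : algebraMap k K a * (frob k K θ - θ) = 0 := by linear_combination h' - h
    simpa [sub_ne_zero.2 hθ] using this
  subst ha
  simpa using h

end Frobenius

/-! ### Frobenius on the projective plane -/

section Plane

variable {k : Type*} [Field k] {K : Type*} [Field K] [Algebra k K]

/-- Extension of scalars for vectors. -/
def ofBase (v : Fin 3 → k) : Fin 3 → K := fun i => algebraMap k K (v i)

variable (K) in
theorem ofBase_ne_zero {v : Fin 3 → k} (h : v ≠ 0) : (ofBase v : Fin 3 → K) ≠ 0 := by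
  contrapose! h
  ext i
  simpa [ofBase] using congrFun h i

variable [Fintype k]

theorem frobVec_ofBase (v : Fin 3 → k) : frobVec k K (ofBase v) = ofBase v := by
  ext i
  exact frob_algebraMap (v i)

theorem frobPlane_mk (v : Fin 3 → K) (h : v ≠ 0) :
    frobPlane k (Projectivization.mk K v h) = Projectivization.mk K (frobVec k K v)
      ((map_ne_zero_iff _ (frobVec_injective k)).2 h) := rfl

theorem frobPlane_injective :
    Function.Injective (frobPlane k : ℙ K (Fin 3 → K) → ℙ K (Fin 3 → K)) := by
  intro x y
  induction x with | h v hv =>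
  induction y with | h w hw =>
  rw [frobPlane_mk, frobPlane_mk, Projectivization.mk_eq_mk_iff_crossProduct_eq_zero,
    Projectivization.mk_eq_mk_iff_crossProduct_eq_zero]
  intro h
  apply frobVec_injective k
  rw [map_zero, ← h]
  ext i
  fin_cases i <;> simp [cross_apply, frobVec]

theorem orthogonal_frobPlane {x m : ℙ K (Fin 3 → K)} (h : x.orthogonal m) :
    (frobPlane k x).orthogonal (frobPlane k m) := by
  induction x with | h v hv =>
  induction m with | h w hw =>
  rw [Projectivization.orthogonal_mk] at h
  rw [frobPlane_mk, frobPlane_mk, Projectivization.orthogonal_mk]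
  simpa [dotProduct, frobVec] using congrArg (frob k K) h

theorem frobPlane_mk_ofBase (v : Fin 3 → k) (h : (ofBase v : Fin 3 → K) ≠ 0) :
    frobPlane k (Projectivization.mk K (ofBase v) h) = Projectivization.mk K (ofBase v) h := by
  simp only [frobPlane_mk, frobVec_ofBase]

/-- Frobenius multiplies all coordinates of a representative by one scalar, so their quotients by a
nonzero coordinate are fixed. -/
theorem exists_mk_ofBase {x : ℙ K (Fin 3 → K)} (hx : frobPlane k x = x) :
    ∃ v : Fin 3 → k, ∃ h : v ≠ 0, x = Projectivization.mk K (ofBase v) (ofBase_ne_zero K h) := by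
  induction x with | h w hw =>
  obtain ⟨i, hi⟩ := Function.ne_iff.1 hw
  have hi : w i ≠ 0 := hi
  rw [frobPlane_mk, Projectivization.mk_eq_mk_iff'] at hx
  obtain ⟨c, hc⟩ := hx
  have hc' : ∀ j, frob k K (w j) = c * w j := fun j => (congrFun hc j).symm
  have hc0 : c ≠ 0 := by
    rintro rfl
    have := hc' i
    simp [hi] at this
  have hfix : ∀ j, ∃ a : k, algebraMap k K a = w j / w i := fun j => by
    apply exists_algebraMap_of_frob_eq
    rw [map_div₀, hc', hc', mul_div_mul_left _ _ hc0]
  choose v hv using hfix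
  have hvi : v i ≠ 0 := by
    intro h0
    have := hv i
    rw [h0, div_self hi] at this
    simp at this
  refine ⟨v, fun h => hvi (congrFun h i), ?_⟩
  rw [Projectivization.mk_eq_mk_iff']
  refine ⟨w i, ?_⟩
  ext j
  simp [ofBase, hv, mul_div_cancel₀ _ hi]

end Plane

/-! ### Point counts of conics -/

section Conics

/-- A quadratic form on a three-dimensional space over a finite field with `q` elements that
vanishes identically on no plane has at most `q ^ 2` zeros. -/
theorem card_zeros_quadraticForm_le {k V : Type*} [Field k] [Fintype k] [AddCommGroup V]
    [Module k V] (hV : Module.finrank k V = 3) (H : QuadraticForm k V)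
    (hH : ∀ u w : V, LinearIndependent k ![u, w] → H u = 0 → H w = 0 →
      QuadraticMap.polar H u w ≠ 0) :
    Nat.card {v : V // H v = 0} ≤ Fintype.card k ^ 2 := by
  classical
  have : FiniteDimensional k V := FiniteDimensional.of_finrank_pos (by omega)
  have : Finite V := Module.finite_of_finite k
  by_cases hex : ∃ Q, Q ≠ 0 ∧ H Q = 0
  swap
  · push Not at hex
    have : Subsingleton {v : V // H v = 0} :=
      ⟨fun a b => Subtype.ext (by
        rw [not_imp_not.1 (hex a.1) a.2, not_imp_not.1 (hex b.1) b.2])⟩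
    calc _ ≤ 1 := Finite.card_le_one_iff_subsingleton.2 this
      _ ≤ _ := Nat.one_le_pow _ _ Fintype.card_pos
  obtain ⟨Q, hQ0, hQ⟩ := hex
  let B : V →ₗ[k] k := QuadraticMap.polarBilin H Q
  have hB : ∀ v (c : k), H (v + c • Q) = H v + c * B v := by
    intro v c
    have h1 : H (v + c • Q) = H v + H (c • Q) + QuadraticMap.polar H v (c • Q) := by
      simp [QuadraticMap.polar]
    rw [h1, QuadraticMap.map_smul, hQ, QuadraticMap.polar_smul_right,
      QuadraticMap.polar_comm]
    simp [B]
  have hBQ : B Q = 0 := by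
    simp [B, hQ]
  have hquot : Nat.card (V ⧸ (k ∙ Q)) = Fintype.card k ^ 2 := by
    rw [Module.natCard_eq_pow_finrank (K := k), Nat.card_eq_fintype_card]
    have := Submodule.finrank_quotient_add_finrank (k ∙ Q)
    rw [finrank_span_singleton hQ0, hV] at this
    rw [show Module.finrank k (V ⧸ (k ∙ Q)) = 2 by omega]
  -- B has rank at most 1, so its kernel is larger than the line of Q, on which B vanishes.
  have hker : ∃ κ, B κ = 0 ∧ κ ∉ (k ∙ Q) := by
    by_contra! hcon
    have hle : LinearMap.ker B ≤ (k ∙ Q) := fun κ hκ => hcon κ hκ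
    have h1 := Submodule.finrank_mono hle
    rw [finrank_span_singleton hQ0] at h1
    have h2 := B.finrank_range_add_finrank_ker
    have h3 := Submodule.finrank_le (LinearMap.range B)
    rw [Module.finrank_self] at h3
    omega
  obtain ⟨κ, hκ, hκQ⟩ := hker
  have hBv : ∀ v, H v = 0 → B v = 0 → v ∈ (k ∙ Q) := by
    intro v hv hBv
    by_contra hvQ
    refine hH Q v ?_ hQ hv hBv
    rw [LinearIndependent.pair_iff' hQ0]
    intro a ha
    exact hvQ (Submodule.mem_span_singleton.2 ⟨a, ha⟩)
  have hcoef : ∀ v : V, ∃ c : k, v ∈ (k ∙ Q) → v = c • Q := by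
    intro v
    by_cases hv : v ∈ (k ∙ Q)
    · obtain ⟨c, hc⟩ := Submodule.mem_span_singleton.1 hv
      exact ⟨c, fun _ => hc.symm⟩
    · exact ⟨0, fun h => absurd h hv⟩
  choose coef hcoef using hcoef
  have hBmem : ∀ v ∈ (k ∙ Q), B v = 0 := by
    intro v hv
    rw [hcoef v hv, map_smul, hBQ, smul_zero]
  -- A zero off the line of Q goes to its class, and c Q goes to the class of c κ, since the
  -- quotient would collapse that line. The two kinds of images are disjoint: B vanishes at Q and κ
  -- but at no zero off the line.
  let T : {v : V // H v = 0} → V ⧸ (k ∙ Q) := fun v =>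
    if v.1 ∈ (k ∙ Q) then Submodule.Quotient.mk (coef v.1 • κ) else Submodule.Quotient.mk v.1
  rw [← hquot]
  have : Finite (V ⧸ (k ∙ Q)) := Module.finite_of_finite k
  have hmixed : ∀ v : V, H v = 0 → v ∉ (k ∙ Q) → ∀ c : k, v - c • κ ∉ (k ∙ Q) := by
    intro v hv0 hv c hmem
    apply hv
    apply hBv v hv0
    have := hBmem _ hmem
    rwa [map_sub, map_smul, hκ, smul_zero, sub_zero] at this
  refine Nat.card_le_card_of_injective T ?_
  rintro ⟨v, hv⟩ ⟨w, hw⟩ h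
  apply Subtype.ext
  simp only [T] at h
  split_ifs at h with h1 h2 h2 <;> rw [Submodule.Quotient.eq] at h
  · rw [← sub_smul] at h
    have : coef v - coef w = 0 := by
      by_contra h0
      exact hκQ ((Submodule.smul_mem_iff _ h0).1 h)
    exact (hcoef v h1).trans ((sub_eq_zero.1 this) ▸ (hcoef w h2).symm)
  · exact absurd (by simpa using Submodule.neg_mem _ h) (hmixed w hw h2 (coef v))
  · exact absurd h (hmixed v hv h1 _)
  -- Along the direction Q the form is affine with slope B w ≠ 0, so each class contains only one
  -- zero.
  · obtain ⟨c, hc⟩ := Submodule.mem_span_singleton.1 h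
    have hvw : v = w + c • Q := by rw [hc]; abel
    have := hB w c
    rw [← hvw, hv, hw, zero_add, eq_comm, mul_eq_zero] at this
    rcases this with h0 | h0
    · simp [hvw, h0]
    · exact absurd (hBv w hw h0) h2

/-- The conic `c z² + z (a₁ s + a₂ t) + (b₀ s² + b₁ s t + b₂ t²)`. -/
def conic {R : Type*} [CommRing R] (c a₁ a₂ b₀ b₁ b₂ z s t : R) : R :=
  c * z ^ 2 + z * (a₁ * s + a₂ * t) + (b₀ * s ^ 2 + b₁ * s * t + b₂ * t ^ 2)

/-- Representatives of the points of the projective line. -/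
def dir {k : Type*} [Field k] (d : Option k) : k × k := d.elim (0, 1) fun t => (1, t)

variable {k : Type*} [Field k]

@[simp] theorem dir_none : dir (none : Option k) = (0, 1) := rfl

@[simp] theorem dir_some (t : k) : dir (some t) = (1, t) := rfl

theorem exists_eq_mul_dir (s t : k) : ∃ (d : Option k) (c : k),
    s = c * (dir d).1 ∧ t = c * (dir d).2 := by
  by_cases hs : s = 0
  · exact ⟨none, t, by simp [hs], by simp⟩
  · exact ⟨some (t / s), s, by simp, by simp [mul_div_cancel₀ _ hs]⟩

theorem dir_det_ne_zero {d d' : Option k} (h : d ≠ d') :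
    (dir d).1 * (dir d').2 - (dir d).2 * (dir d').1 ≠ 0 := by
  rcases d with _ | t <;> rcases d' with _ | t' <;> simp_all [sub_eq_zero, eq_comm]

theorem dir_ne_zero (d : Option k) : (dir d).1 ≠ 0 ∨ (dir d).2 ≠ 0 := by
  rcases d with _ | t <;> simp

theorem eq_zero_of_mul_dir {d : Option k} {c : k} (h1 : c * (dir d).1 = 0)
    (h2 : c * (dir d).2 = 0) : c = 0 := by
  rcases dir_ne_zero d with h | h <;> simp_all

theorem dir_eq_of_mul_eq {d d' : Option k} {c c' : k} (hc : c ≠ 0)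
    (h1 : c * (dir d).1 = c' * (dir d').1) (h2 : c * (dir d).2 = c' * (dir d').2) :
    d = d' ∧ c = c' := by
  have hd : d = d' := by
    by_contra h
    apply dir_det_ne_zero h
    apply mul_left_cancel₀ hc
    linear_combination (dir d').2 * h1 - (dir d').1 * h2
  subst hd
  refine ⟨rfl, sub_eq_zero.1 (eq_zero_of_mul_dir (d := d) ?_ ?_)⟩
  · linear_combination h1
  · linear_combination h2

variable [Fintype k] {K : Type*} [Field K] [Algebra k K]

/-- A conic over `k` without rational component has at most `q + 1` points. -/
theorem card_conic_le (c a₁ a₂ b₀ b₁ b₂ : k) (hc : c ≠ 0) {θ : K}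
    (hθ' : frob k K (frob k K θ) = θ)
    (hz : ∀ z : K, frob k K (frob k K z) = z →
      conic (algebraMap k K c) (algebraMap k K a₁) (algebraMap k K a₂) (algebraMap k K b₀)
        (algebraMap k K b₁) (algebraMap k K b₂) z θ 1 ≠ 0) :
    Nat.card {p : Option k × k // conic c a₁ a₂ b₀ b₁ b₂ p.2 (dir p.1).1 (dir p.1).2 = 0} ≤
      Fintype.card k + 1 := by
  classical
  let pr : Fin 3 → ((Fin 3 → k) →ₗ[k] k) := fun i => LinearMap.proj i
  let H : QuadraticForm k (Fin 3 → k) :=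
    c • QuadraticMap.linMulLin (pr 0) (pr 0) + a₁ • QuadraticMap.linMulLin (pr 0) (pr 1) +
    a₂ • QuadraticMap.linMulLin (pr 0) (pr 2) + b₀ • QuadraticMap.linMulLin (pr 1) (pr 1) +
    b₁ • QuadraticMap.linMulLin (pr 1) (pr 2) + b₂ • QuadraticMap.linMulLin (pr 2) (pr 2)
  have hHv : ∀ v, H v = conic c a₁ a₂ b₀ b₁ b₂ (v 0) (v 1) (v 2) := by
    intro v
    simp only [H, pr, conic, add_apply, smul_apply,
      QuadraticMap.linMulLin_apply, LinearMap.proj_apply, smul_eq_mul]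
    ring
  have hcomb : ∀ (u w : Fin 3 → k) (a b : K), H u = 0 → H w = 0 → QuadraticMap.polar H u w = 0 →
      conic (algebraMap k K c) (algebraMap k K a₁) (algebraMap k K a₂) (algebraMap k K b₀)
        (algebraMap k K b₁) (algebraMap k K b₂)
        (a * algebraMap k K (u 0) + b * algebraMap k K (w 0))
        (a * algebraMap k K (u 1) + b * algebraMap k K (w 1))
        (a * algebraMap k K (u 2) + b * algebraMap k K (w 2)) = 0 := by
    intro u w a b hu hw huw
    rw [QuadraticMap.polar, hu, hw] at huw
    rw [hHv] at hu hw huw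
    have h1 := congrArg (algebraMap k K) hu
    have h2 := congrArg (algebraMap k K) hw
    have h3 := congrArg (algebraMap k K) huw
    simp only [conic, Pi.add_apply, map_add, map_sub, map_mul, map_pow, map_zero] at h1 h2 h3 ⊢
    linear_combination (a ^ 2 - a * b) * h1 + (b ^ 2 - a * b) * h2 + a * b * h3
  -- A plane of zeros either contains (1, 0, 0), where the form takes the value c ≠ 0, or after
  -- extension to K contains a vector (z, θ, 1) with z fixed by φ², which `hz` excludes.
  have hH : ∀ u w : Fin 3 → k, LinearIndependent k ![u, w] → H u = 0 → H w = 0 →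
      QuadraticMap.polar H u w ≠ 0 := by
    intro u w hind hu hw huw
    by_cases hΔ : w 1 * u 2 - u 1 * w 2 = 0
    · have hker : ∃ a b : k, (a ≠ 0 ∨ b ≠ 0) ∧ a * u 1 + b * w 1 = 0 ∧ a * u 2 + b * w 2 = 0 := by
        by_cases h1 : u 1 = 0 ∧ w 1 = 0
        · by_cases h2 : u 2 = 0 ∧ w 2 = 0
          · exact ⟨1, 0, by simp, by simp [h1], by simp [h2]⟩
          · refine ⟨w 2, -u 2, ?_, by simp [h1], by ring⟩
            rw [neg_ne_zero]
            tauto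
        · refine ⟨w 1, -u 1, ?_, by ring, by linear_combination hΔ⟩
          rw [neg_ne_zero]
          tauto
      obtain ⟨a, b, hab, h1, h2⟩ := hker
      have h0 := hcomb u w (algebraMap k K a) (algebraMap k K b) hu hw huw
      simp only [← map_mul, ← map_add] at h0
      rw [h1, h2] at h0
      simp only [conic, map_zero, mul_zero, add_zero, ne_eq, OfNat.ofNat_ne_zero,
        not_false_eq_true, zero_pow, mul_eq_zero, map_eq_zero, hc, false_or, pow_eq_zero_iff] at h0
      rw [LinearIndependent.pair_iff] at hind
      have := hind a b (by
        ext i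
        fin_cases i
        · exact h0
        · exact h1
        · exact h2)
      tauto
    · have hΔ' : algebraMap k K (w 1 * u 2 - u 1 * w 2) ≠ 0 := by
        rwa [map_ne_zero]
      -- Cramer's rule: the last two coordinates of a u + b w become θ and 1.
      let a : K := (algebraMap k K (w 1) - θ * algebraMap k K (w 2)) /
        algebraMap k K (w 1 * u 2 - u 1 * w 2)
      let b : K := (θ * algebraMap k K (u 2) - algebraMap k K (u 1)) /
        algebraMap k K (w 1 * u 2 - u 1 * w 2)
      have h0 := hcomb u w a b hu hw huw
      have h1 : a * algebraMap k K (u 1) + b * algebraMap k K (w 1) = θ := by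
        rw [div_mul_eq_mul_div, div_mul_eq_mul_div, ← add_div, div_eq_iff hΔ', map_sub, map_mul,
          map_mul]
        ring
      have h2 : a * algebraMap k K (u 2) + b * algebraMap k K (w 2) = 1 := by
        rw [div_mul_eq_mul_div, div_mul_eq_mul_div, ← add_div, div_eq_iff hΔ', map_sub, map_mul,
          map_mul]
        ring
      rw [h1, h2] at h0
      refine hz _ ?_ h0
      simp only [a, b, map_add, map_mul, map_div₀, map_sub, frob_algebraMap, hθ']
  have hcard := card_zeros_quadraticForm_le (by simp) H hH
  let N := Nat.card {p : Option k × k //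
    conic c a₁ a₂ b₀ b₁ b₂ p.2 (dir p.1).1 (dir p.1).2 = 0}
  -- The zero vector and the q - 1 multiples of each of the N points are distinct zeros, so N (q -
  -- 1) + 1 ≤ q².
  let T : Option ({p : Option k × k // conic c a₁ a₂ b₀ b₁ b₂ p.2 (dir p.1).1 (dir p.1).2 = 0} × kˣ)
      → {v : Fin 3 → k // H v = 0} := fun o => o.elim ⟨0, by simp⟩ fun x =>
    ⟨![x.2 * x.1.1.2, x.2 * (dir x.1.1.1).1, x.2 * (dir x.1.1.1).2], by
      rw [hHv]
      have := x.1.2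
      simp only [conic, Matrix.cons_val] at this ⊢
      linear_combination (x.2 : k) ^ 2 * this⟩
  have hT : Function.Injective T := by
    rintro (_ | ⟨⟨⟨d, z⟩, hp⟩, u⟩) (_ | ⟨⟨⟨d', z'⟩, hp'⟩, u'⟩) h
    · rfl
    · have h := congrArg Subtype.val h
      have h1 := congrFun h 1
      have h2 := congrFun h 2
      simp only [T, Option.elim, Pi.zero_apply, Matrix.cons_val] at h1 h2
      exact absurd (eq_zero_of_mul_dir h1.symm h2.symm) u'.ne_zero
    · have h := congrArg Subtype.val h
      have h1 := congrFun h 1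
      have h2 := congrFun h 2
      simp only [T, Option.elim, Pi.zero_apply, Matrix.cons_val] at h1 h2
      exact absurd (eq_zero_of_mul_dir h1 h2) u.ne_zero
    · have h := congrArg Subtype.val h
      have h0 := congrFun h 0
      have h1 := congrFun h 1
      have h2 := congrFun h 2
      simp only [T, Option.elim, Matrix.cons_val] at h0 h1 h2
      obtain ⟨hd, hu⟩ := dir_eq_of_mul_eq u.ne_zero h1 h2
      obtain rfl := Units.ext hu
      obtain rfl := mul_left_cancel₀ u.ne_zero h0
      subst hd
      rfl
  have hle := (Nat.card_le_card_of_injective T hT).trans hcard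
  rw [Finite.card_option, Nat.card_prod, Nat.card_units, Nat.card_eq_fintype_card (α := k)] at hle
  have hq := Fintype.one_lt_card (α := k)
  obtain ⟨m, hm⟩ : ∃ m, Fintype.card k = m + 2 := ⟨Fintype.card k - 2, by omega⟩
  rw [hm] at hle ⊢
  simp only [Nat.add_succ_sub_one] at hle
  by_contra! hlt
  nlinarith [Nat.mul_le_mul_right (m + 1) hlt]

end Conics

/-! ### The pencil of conics through a point of degree 4 -/

section Pencil

variable {k : Type*} [Field k] [Fintype k] {K : Type*} [Field K] [Algebra k K]

theorem frob_conic (c a₁ a₂ b₀ b₁ b₂ : k) (z s t : K) :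
    frob k K (conic (algebraMap k K c) (algebraMap k K a₁) (algebraMap k K a₂)
      (algebraMap k K b₀) (algebraMap k K b₁) (algebraMap k K b₂) z s t) =
    conic (algebraMap k K c) (algebraMap k K a₁) (algebraMap k K a₂)
      (algebraMap k K b₀) (algebraMap k K b₁) (algebraMap k K b₂)
      (frob k K z) (frob k K s) (frob k K t) := by
  simp only [conic, map_add, map_mul, map_pow, frob_algebraMap]

/-- Above θ the equation is quadratic in z, and its roots are already ζ and its conjugate φ² ζ,
neither of them fixed by φ². -/
theorem conic_ne_zero_of_frob_frob_eq (c a₁ a₂ b₀ b₁ b₂ : k) (hc : c ≠ 0) {θ ζ : K}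
    (hθ' : frob k K (frob k K θ) = θ) (hζ : frob k K (frob k K ζ) ≠ ζ)
    (h : conic (algebraMap k K c) (algebraMap k K a₁) (algebraMap k K a₂)
      (algebraMap k K b₀) (algebraMap k K b₁) (algebraMap k K b₂) ζ θ 1 = 0) (z : K)
    (hz : frob k K (frob k K z) = z) :
    conic (algebraMap k K c) (algebraMap k K a₁) (algebraMap k K a₂) (algebraMap k K b₀)
        (algebraMap k K b₁) (algebraMap k K b₂) z θ 1 ≠ 0 := by
  intro h0
  have h' := congrArg (fun x => frob k K (frob k K x)) h
  simp only [frob_conic, hθ', map_one, map_zero] at h'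
  have hc' : algebraMap k K c ≠ 0 := by rwa [map_ne_zero]
  have hzζ : z ≠ ζ := by
    rintro rfl
    exact hζ hz
  have h1 : algebraMap k K c * (ζ + frob k K (frob k K ζ)) +
      (algebraMap k K a₁ * θ + algebraMap k K a₂) = 0 := by
    apply mul_left_cancel₀ (sub_ne_zero.2 hζ)
    simp only [conic] at h h'
    linear_combination h' - h
  have h2 : algebraMap k K c * (ζ + z) + (algebraMap k K a₁ * θ + algebraMap k K a₂) = 0 := by
    apply mul_left_cancel₀ (sub_ne_zero.2 hzζ)
    simp only [conic] at h h0
    linear_combination h0 - h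
  have h3 : z = frob k K (frob k K ζ) := by
    apply mul_left_cancel₀ hc'
    linear_combination h2 - h1
  exact hzζ ((frob k K).injective ((frob k K).injective (hz.trans h3)))

open Classical in
-- The involution z ↦ -b - z preserves f, so a fibre of f has at least two elements unless it
-- contains a fixed point of the involution.
theorem two_mul_card_image_le {R : Type*} [CommRing R] [Fintype R] {α : Type*} (b : R)
    (f : R → α) (hf : ∀ x y, x ^ 2 + x * b = y ^ 2 + y * b → f x = f y) :
    2 * (Finset.univ.image f).card ≤
      Fintype.card R + (Finset.univ.filter fun z : R => 2 * z = -b).card := by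
  have h1 := Finset.card_eq_sum_card_image f (Finset.univ : Finset R)
  have h2 := Finset.card_eq_sum_card_fiberwise (f := f)
    (s := Finset.univ.filter fun z : R => 2 * z = -b) (t := Finset.univ.image f)
    (fun x _ => by simp)
  rw [← Finset.card_univ, h1, h2, ← Finset.sum_add_distrib, mul_comm, ← smul_eq_mul,
    ← Finset.sum_const]
  apply Finset.sum_le_sum
  intro y hy
  obtain ⟨z, -, rfl⟩ := Finset.mem_image.1 hy
  by_cases hz : 2 * z = -b
  · have h3 : 0 < (Finset.univ.filter fun x => f x = f z).card :=
      Finset.card_pos.2 ⟨z, by simp⟩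
    have h4 : 0 < ((Finset.univ.filter fun x => 2 * x = -b).filter fun x => f x = f z).card :=
      Finset.card_pos.2 ⟨z, by simpa using hz⟩
    omega
  · have h3 : 1 < (Finset.univ.filter fun x => f x = f z).card := by
      refine Finset.one_lt_card.2 ⟨z, by simp, -b - z, ?_, ?_⟩
      · simp only [Finset.mem_filter, Finset.mem_univ, true_and]
        apply hf
        ring
      · intro h
        apply hz
        linear_combination h
    omega

/-- In the pencil of conics through the closed point of degree `4` over `(ζ, θ, 1)` there is one
with `q + 1` points that is missed by two rational lines through `(1, 0, 0)`. -/
theorem exists_conic_through (hq : 3 ≤ Fintype.card k) {θ ζ : K} (hθ : frob k K θ ≠ θ)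
    (hθ' : frob k K (frob k K θ) = θ) (hζ : frob k K (frob k K ζ) ≠ ζ)
    (hζ' : frob k K (frob k K (frob k K (frob k K ζ))) = ζ) :
    ∃ a₁ a₂ b₀ b₁ b₂ : k, ∃ d₁ d₂ : Option k, d₁ ≠ d₂ ∧
      conic 1 (algebraMap k K a₁) (algebraMap k K a₂)
        (algebraMap k K b₀) (algebraMap k K b₁) (algebraMap k K b₂) ζ θ 1 = 0 ∧
      (∀ z, conic 1 a₁ a₂ b₀ b₁ b₂ z (dir d₁).1 (dir d₁).2 ≠ 0) ∧
      (∀ z, conic 1 a₁ a₂ b₀ b₁ b₂ z (dir d₂).1 (dir d₂).2 ≠ 0) ∧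
      Nat.card {p : Option k × k // conic 1 a₁ a₂ b₀ b₁ b₂ p.2 (dir p.1).1 (dir p.1).2 = 0} =
        Fintype.card k + 1 := by
  classical
  -- The coefficients of (z - ζ)(z - φ² ζ) are fixed by φ², hence of the form aθ + b. This gives one
  -- conic of the pencil, with b₀ = 0.
  obtain ⟨a₁, a₂, ha⟩ := exists_eq_mul_add_of_frob_frob_eq hθ hθ'
    (x := -(ζ + frob k K (frob k K ζ))) (by simp only [map_neg, map_add, hζ']; ring)
  obtain ⟨b₁, b₂, hb⟩ := exists_eq_mul_add_of_frob_frob_eq hθ hθ'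
    (x := ζ * frob k K (frob k K ζ)) (by simp only [map_mul, hζ']; ring)
  -- The norm form s² + n₁ s t + n₂ t² = (s - θ t)(s - φθ t) defines the two conjugate lines. Adding
  -- x times it sweeps out the pencil.
  obtain ⟨n₁, hn₁⟩ := exists_algebraMap_of_frob_eq (k := k) (x := -(θ + frob k K θ))
    (by simp only [map_neg, map_add, hθ']; ring)
  obtain ⟨n₂, hn₂⟩ := exists_algebraMap_of_frob_eq (k := k) (x := θ * frob k K θ)
    (by simp only [map_mul, hθ']; ring)
  have hN : ∀ d : Option k,
      (dir d).1 ^ 2 + n₁ * (dir d).1 * (dir d).2 + n₂ * (dir d).2 ^ 2 ≠ 0 := by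
    intro d h
    have h1 := congrArg (algebraMap k K) h
    simp only [map_add, map_mul, map_pow, map_zero, hn₁, hn₂] at h1
    have h2 : (algebraMap k K (-(dir d).2) * θ + algebraMap k K (dir d).1) *
        frob k K (algebraMap k K (-(dir d).2) * θ + algebraMap k K (dir d).1) = 0 := by
      simp only [map_add, map_mul, frob_algebraMap]
      simp only [map_neg]
      linear_combination h1
    have h3 : algebraMap k K (-(dir d).2) * θ + algebraMap k K (dir d).1 = 0 := by
      rcases mul_eq_zero.1 h2 with h3 | h3
      · exact h3
      · simpa only [map_eq_zero] using h3
    obtain ⟨h4, h5⟩ := eq_zero_of_mul_add_eq_zero hθ h3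
    rcases dir_ne_zero d with h6 | h6
    · exact h6 h5
    · exact h6 (neg_eq_zero.1 h4)
  -- The parameter of the unique member through the rational point (d, z).
  let τ : Option k → k → k := fun d z => -conic 1 a₁ a₂ 0 b₁ b₂ z (dir d).1 (dir d).2 /
    ((dir d).1 ^ 2 + n₁ * (dir d).1 * (dir d).2 + n₂ * (dir d).2 ^ 2)
  have hτ : ∀ x d z, conic 1 a₁ a₂ x (b₁ + x * n₁) (b₂ + x * n₂) z (dir d).1 (dir d).2 = 0 ↔
      τ d z = x := by
    intro x d z
    simp only [τ]
    rw [div_eq_iff (hN d)]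
    simp only [conic]
    constructor <;> intro h <;> linear_combination -h
  have hmem : ∀ x, conic (algebraMap k K 1) (algebraMap k K a₁) (algebraMap k K a₂)
        (algebraMap k K x) (algebraMap k K (b₁ + x * n₁)) (algebraMap k K (b₂ + x * n₂))
        ζ θ 1 = 0 := by
    intro x
    simp only [conic, map_add, map_mul, map_one, hn₁, hn₂]
    linear_combination -hb - ζ * ha
  -- The q members partition q (q + 1) points with at most q + 1 in each, so equality holds
  -- throughout.
  have hcard : ∀ x, (Finset.univ.filter fun p : Option k × k => τ p.1 p.2 = x).card =
      Fintype.card k + 1 := by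
    have hle : ∀ x ∈ (Finset.univ : Finset k),
        (Finset.univ.filter fun p : Option k × k => τ p.1 p.2 = x).card ≤
        Fintype.card k + 1 := by
      intro x _
      have := card_conic_le 1 a₁ a₂ x (b₁ + x * n₁) (b₂ + x * n₂) one_ne_zero hθ'
        (conic_ne_zero_of_frob_frob_eq 1 a₁ a₂ x (b₁ + x * n₁) (b₂ + x * n₂) one_ne_zero hθ'
          hζ (hmem x))
      simp only [hτ] at this
      rwa [Nat.card_eq_fintype_card, Fintype.card_subtype] at this
    have hsum := Finset.card_eq_sum_card_fiberwise (s := (Finset.univ : Finset (Option k × k)))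
      (t := (Finset.univ : Finset k)) (f := fun p => τ p.1 p.2) (fun _ _ => by simp)
    have heq := (Finset.sum_eq_sum_iff_of_le hle).1 (by
      rw [← hsum]
      simp
      ring)
    exact fun x => heq x (Finset.mem_univ x)
  let ext : k → Option k → Prop := fun x d => ∀ z, τ d z ≠ x
  have hext : Fintype.card k < ∑ d : Option k, (Finset.univ.filter fun x => ext x d).card := by
    let b : Option k → k := fun d => a₁ * (dir d).1 + a₂ * (dir d).2
    have h1 : ∀ d : Option k, Fintype.card k ≤ 2 * (Finset.univ.filter fun x => ext x d).card +
        (Finset.univ.filter fun z : k => 2 * z = - b d).card := by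
      intro d
      have h2 := two_mul_card_image_le (b d) (τ d) (by
        intro x y hxy
        simp only [τ, b, conic] at hxy ⊢
        congr 1
        linear_combination -hxy)
      have h3 : (Finset.univ.filter fun x => ext x d) = (Finset.univ.image (τ d))ᶜ := by
        ext x
        simp [ext]
      have h4 := Finset.card_compl_add_card (Finset.univ.image (τ d))
      rw [h3]
      omega
    have h2 : ∑ d : Option k, (Finset.univ.filter fun z : k => 2 * z = - b d).card ≤
        Fintype.card k + 1 := by
      -- In characteristic 2 a direction contributes q if b d = 0 and nothing otherwise. There is at
      -- most one with b d = 0, since the linear form b is nonzero: b = 0 would give ζ = φ² ζ. In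
      -- other characteristics each direction contributes 1.
      by_cases htwo : (2 : k) = 0
      · have hL : a₁ ≠ 0 ∨ a₂ ≠ 0 := by
          by_contra! h
          apply hζ
          rw [h.1, h.2] at ha
          have h2 : (2 : K) = 0 := by
            rw [← map_ofNat (algebraMap k K) 2, htwo, map_zero]
          simp only [map_zero] at ha
          linear_combination -ha - ζ * h2
        have hinj : ∀ d d' : Option k, b d = 0 → b d' = 0 → d = d' := by
          intro d d' h h'
          by_contra hne
          have hdet := dir_det_ne_zero hne
          rcases hL with hL | hL
          · apply mul_ne_zero hL hdet
            simp only [b] at h h'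
            linear_combination (dir d').2 * h - (dir d).2 * h'
          · apply mul_ne_zero hL hdet
            simp only [b] at h h'
            linear_combination (dir d).1 * h' - (dir d').1 * h
        rw [← Finset.card_sigma]
        refine (Finset.card_le_card_of_injOn (t := (Finset.univ : Finset k)) (fun p => p.2)
          (fun _ _ => by simp) ?_).trans (by simp)
        rintro ⟨d, z⟩ hd ⟨d', z'⟩ hd' (rfl : z = z')
        simp only [htwo, zero_mul, Finset.coe_sigma, Finset.coe_filter, Set.mem_sigma_iff,
          Finset.mem_coe, Finset.mem_univ, true_and, Set.mem_ofPred_eq] at hd hd'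
        rw [hinj d d' (neg_eq_zero.1 hd.symm) (neg_eq_zero.1 hd'.symm)]
      · calc _ ≤ ∑ _d : Option k, 1 := by
              refine Finset.sum_le_sum fun d _ => Finset.card_le_one.2 ?_
              intro x hx y hy
              simp only [Finset.mem_filter, Finset.mem_univ, true_and] at hx hy
              exact mul_left_cancel₀ htwo (hx.trans hy.symm)
          _ = _ := by simp
    have h3 := Finset.sum_le_sum fun d (_ : d ∈ (Finset.univ : Finset (Option k))) => h1 d
    rw [Finset.sum_add_distrib, ← Finset.mul_sum] at h3
    simp only [Finset.sum_const, Finset.card_univ, Fintype.card_option, smul_eq_mul] at h3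
    -- With S the sum in the goal, q (q + 1) ≤ 2 S + (q + 1), so 2 S ≥ q² - 1, which exceeds 2 q
    -- because q ≥ 3.
    nlinarith
  have hswap : ∑ x : k, (Finset.univ.filter fun d => ext x d).card =
      ∑ d : Option k, (Finset.univ.filter fun x => ext x d).card :=
    Finset.sum_card_bipartiteAbove_eq_sum_card_bipartiteBelow ext
  obtain ⟨x, -, hx⟩ := Finset.exists_lt_of_sum_lt (s := (Finset.univ : Finset k))
    (f := fun _ => 1) (g := fun x => (Finset.univ.filter fun d => ext x d).card) (by
      rw [hswap]
      simpa using hext)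
  obtain ⟨d₁, hd₁, d₂, hd₂, hne⟩ := Finset.one_lt_card.1 hx
  simp only [Finset.mem_filter, Finset.mem_univ, true_and] at hd₁ hd₂
  refine ⟨a₁, a₂, x, b₁ + x * n₁, b₂ + x * n₂, d₁, d₂, hne, ?_, ?_, ?_, ?_⟩
  · simpa using hmem x
  · intro z h
    exact hd₁ z ((hτ _ _ _).1 h)
  · intro z h
    exact hd₂ z ((hτ _ _ _).1 h)
  · simp only [hτ]
    rw [Nat.card_eq_fintype_card, Fintype.card_subtype, hcard]

end Pencil

/-! ### Rational points of the blow-up as pairs (direction, position) -/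

section Frames

variable {k : Type*} [Field k] {K : Type*} [Field K] [Algebra k K]

/-- Proportionality is the vanishing of the cross product, which does not depend on the field. -/
theorem mk_ofBase_eq_iff {v w : Fin 3 → k} (hv : v ≠ 0) (hw : w ≠ 0) :
    Projectivization.mk K (ofBase v) (ofBase_ne_zero K hv) =
      Projectivization.mk K (ofBase w) (ofBase_ne_zero K hw) ↔ ∃ c : k, c • w = v := by
  rw [Projectivization.mk_eq_mk_iff_crossProduct_eq_zero, ← Projectivization.mk_eq_mk_iff' k v w
    hv hw, Projectivization.mk_eq_mk_iff_crossProduct_eq_zero]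
  have h : crossProduct (ofBase v : Fin 3 → K) (ofBase w) = ofBase (crossProduct v w) := by
    ext i
    fin_cases i <;> simp [cross_apply, ofBase]
  rw [h]
  constructor
  · intro h0
    by_contra h1
    exact ofBase_ne_zero K h1 h0
  · intro h0
    rw [h0]
    ext i
    simp [ofBase]

theorem orthogonal_mk_ofBase_iff {v w : Fin 3 → k} (hv : v ≠ 0) (hw : w ≠ 0) :
    (Projectivization.mk K (ofBase v) (ofBase_ne_zero K hv)).orthogonal
      (Projectivization.mk K (ofBase w) (ofBase_ne_zero K hw)) ↔ v ⬝ᵥ w = 0 := by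
  rw [Projectivization.orthogonal_mk, ← map_eq_zero (algebraMap k K)]
  simp [dotProduct, ofBase]

theorem mulVec_ne_zero {M : Matrix (Fin 3) (Fin 3) k} (hM : M.det ≠ 0) {v : Fin 3 → k}
    (hv : v ≠ 0) : M.mulVec v ≠ 0 :=
  fun h => hv (Matrix.eq_zero_of_mulVec_eq_zero hM h)

variable (K) in
/-- The point with coordinates `v` in the frame given by the columns of `M`. -/
def framePoint (M : Matrix (Fin 3) (Fin 3) k) (hM : M.det ≠ 0) (v : Fin 3 → k) (hv : v ≠ 0) :
    ℙ K (Fin 3 → K) :=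
  Projectivization.mk K (ofBase (M.mulVec v)) (ofBase_ne_zero K (mulVec_ne_zero hM hv))

theorem framePoint_eq_iff {M : Matrix (Fin 3) (Fin 3) k} (hM : M.det ≠ 0) {v w : Fin 3 → k}
    (hv : v ≠ 0) (hw : w ≠ 0) :
    framePoint K M hM v hv = framePoint K M hM w hw ↔ ∃ c : k, c • w = v := by
  rw [framePoint, framePoint, mk_ofBase_eq_iff (mulVec_ne_zero hM hv) (mulVec_ne_zero hM hw)]
  refine exists_congr fun c => ?_
  rw [← Matrix.mulVec_smul, (Matrix.mulVec_injective_of_isUnit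
    ((Matrix.isUnit_iff_isUnit_det M).2 hM.isUnit)).eq_iff]

theorem framePoint_orthogonal_iff {M : Matrix (Fin 3) (Fin 3) k} (hM : M.det ≠ 0)
    {v u : Fin 3 → k} (hv : v ≠ 0) (hu : u ≠ 0) :
    (framePoint K M hM v hv).orthogonal
      (Projectivization.mk K (ofBase u) (ofBase_ne_zero K hu)) ↔
      v ⬝ᵥ (Matrix.vecMul u M) = 0 := by
  rw [framePoint, orthogonal_mk_ofBase_iff (mulVec_ne_zero hM hv) hu, dotProduct_comm, Matrix.dotProduct_mulVec,
    dotProduct_comm]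

theorem exists_framePoint_eq {M : Matrix (Fin 3) (Fin 3) k} (hM : M.det ≠ 0) {v : Fin 3 → k}
    (hv : v ≠ 0) : ∃ x : Fin 3 → k, ∃ hx : x ≠ 0,
      Projectivization.mk K (ofBase v) (ofBase_ne_zero K hv) = framePoint K M hM x hx := by
  have h : M.mulVec (M⁻¹.mulVec v) = v := by
    rw [Matrix.mulVec_mulVec, Matrix.mul_nonsing_inv _ hM.isUnit, Matrix.one_mulVec]
  refine ⟨M⁻¹.mulVec v, ?_, ?_⟩
  · intro h0
    rw [h0, Matrix.mulVec_zero] at h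
    exact hv h.symm
  · simp only [framePoint, h]

theorem exists_frame {v : Fin 3 → k} (hv : v ≠ 0) :
    ∃ M : Matrix (Fin 3) (Fin 3) k, M.det ≠ 0 ∧ M.mulVec ![1, 0, 0] = v := by
  obtain ⟨i, hi⟩ := Function.ne_iff.1 hv
  fin_cases i
  · refine ⟨!![v 0, 0, 0; v 1, 1, 0; v 2, 0, 1], ?_, ?_⟩
    · simpa [Matrix.det_fin_three] using hi
    · ext j
      fin_cases j <;> simp [Matrix.mulVec, dotProduct, Fin.sum_univ_three]
  · refine ⟨!![v 0, 1, 0; v 1, 0, 0; v 2, 0, 1], ?_, ?_⟩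
    · simpa [Matrix.det_fin_three] using hi
    · ext j
      fin_cases j <;> simp [Matrix.mulVec, dotProduct, Fin.sum_univ_three]
  · refine ⟨!![v 0, 1, 0; v 1, 0, 1; v 2, 0, 0], ?_, ?_⟩
    · simpa [Matrix.det_fin_three] using hi
    · ext j
      fin_cases j <;> simp [Matrix.mulVec, dotProduct, Fin.sum_univ_three]

theorem e0_ne_zero : (![1, 0, 0] : Fin 3 → k) ≠ 0 := fun h => by simpa using congrFun h 0

/-- Coordinates of a second point of the line through `(1, 0, 0)` in the direction `d`. -/
def dirVec (d : Option k) : Fin 3 → k := ![0, (dir d).1, (dir d).2]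

theorem dirVec_ne_zero (d : Option k) : dirVec d ≠ 0 := by
  intro h
  have h1 : (dir d).1 = 0 := congrFun h 1
  have h2 : (dir d).2 = 0 := congrFun h 2
  rcases dir_ne_zero d with h0 | h0 <;> contradiction

/-- Coordinates of the points of the line through `(1, 0, 0)` in the direction `d`. -/
def ptVec (d w : Option k) : Fin 3 → k :=
  w.elim ![1, 0, 0] fun z => ![z, (dir d).1, (dir d).2]

theorem ptVec_ne_zero (d w : Option k) : ptVec d w ≠ 0 := by
  rcases w with _ | z
  · exact e0_ne_zero
  · intro h
    have h1 : (dir d).1 = 0 := congrFun h 1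
    have h2 : (dir d).2 = 0 := congrFun h 2
    rcases dir_ne_zero d with h0 | h0 <;> contradiction

theorem framePoint_e0_ne_dirVec {M : Matrix (Fin 3) (Fin 3) k} (hM : M.det ≠ 0) (d : Option k) :
    framePoint K M hM ![1, 0, 0] e0_ne_zero ≠ framePoint K M hM (dirVec d) (dirVec_ne_zero d) := by
  rw [Ne, framePoint_eq_iff]
  rintro ⟨c, hc⟩
  simpa [dirVec] using congrFun hc 0

theorem ptVec_orthogonal {d w : Option k} {b : Fin 3 → k} (h0 : ![1, 0, 0] ⬝ᵥ b = 0)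
    (h1 : dirVec d ⬝ᵥ b = 0) : ptVec d w ⬝ᵥ b = 0 := by
  rcases w with _ | z
  · exact h0
  · simp only [dotProduct, Fin.sum_univ_three, dirVec, ptVec, Matrix.cons_val, Option.elim] at *
    linear_combination z * h0 + h1

variable [Fintype k] {Z : Set (ℙ K (Fin 3 → K))}

theorem frobPlane_framePoint {M : Matrix (Fin 3) (Fin 3) k} (hM : M.det ≠ 0) {v : Fin 3 → k}
    (hv : v ≠ 0) : frobPlane k (framePoint K M hM v hv) = framePoint K M hM v hv :=
  frobPlane_mk_ofBase _ _

/-- The point of the blow-up lies above the point `w` of the line in the direction `d`, and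
above the point `a` its line is that line. -/
def Blowup.HasParam (M : Matrix (Fin 3) (Fin 3) k) (hM : M.det ≠ 0) (a : Z) (y : Blowup Z)
    (d w : Option k) : Prop :=
  y.pt = framePoint K M hM (ptVec d w) (ptVec_ne_zero d w) ∧
    (framePoint K M hM (dirVec d) (dirVec_ne_zero d)).orthogonal (y.line a)

variable {M : Matrix (Fin 3) (Fin 3) k} {hM : M.det ≠ 0} {a : Z}

/-- Above P take the line joining P to the point of direction d; above any other centre b take the
line joining b to the rational point x, which differs from b. Uniqueness of joining lines makes this
choice compatible with Frobenius. -/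
theorem Blowup.exists_hasParam
    (ha : (a : ℙ K (Fin 3 → K)) = framePoint K M hM ![1, 0, 0] e0_ne_zero)
    (hZ : ∀ b ∈ Z, b ≠ a → frobPlane k b ≠ b) (d w : Option k) :
    ∃ y : Blowup Z, y.IsRational k ∧ y.HasParam M hM a d w := by
  classical
  let x : ℙ K (Fin 3 → K) := framePoint K M hM (ptVec d w) (ptVec_ne_zero d w)
  let D : ℙ K (Fin 3 → K) := framePoint K M hM (dirVec d) (dirVec_ne_zero d)
  have hx : frobPlane k x = x := frobPlane_framePoint hM _
  have hD : frobPlane k D = D := frobPlane_framePoint hM _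
  have haf : frobPlane k (a : ℙ K (Fin 3 → K)) = a := by
    rw [ha]
    exact frobPlane_framePoint hM _
  have haD : (a : ℙ K (Fin 3 → K)) ≠ D := by
    rw [ha]
    exact framePoint_e0_ne_dirVec hM d
  have hbx : ∀ b : Z, b ≠ a → (b : ℙ K (Fin 3 → K)) ≠ x := by
    intro b hb h
    refine hZ b b.2 (fun h => hb (Subtype.ext h)) ?_
    rw [h, hx]
  have hline : ∀ b : Z, ∃ m : ℙ K (Fin 3 → K), (b : ℙ K (Fin 3 → K)).orthogonal m ∧
      x.orthogonal m ∧ (b = a → D.orthogonal m) := by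
    intro b
    by_cases hb : b = a
    · subst hb
      let m := Projectivization.cross (b : ℙ K (Fin 3 → K)) D
      have h1 : (b : ℙ K (Fin 3 → K)).orthogonal m := Projectivization.orthogonal_cross_left haD
      have h2 : D.orthogonal m := Projectivization.orthogonal_cross_right haD
      refine ⟨m, h1, ?_, fun _ => h2⟩
      have hm : frobPlane k m = m := by
        have h3 := orthogonal_frobPlane (k := k) h1
        have h4 := orthogonal_frobPlane (k := k) h2
        rw [haf] at h3
        rw [hD] at h4
        exact eq_of_orthogonal haD h3 h4 h1 h2
      obtain ⟨u, hu, hmu⟩ := exists_mk_ofBase hm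
      rw [hmu] at h1 h2 ⊢
      rw [ha, framePoint_orthogonal_iff hM _ hu] at h1
      rw [framePoint_orthogonal_iff hM _ hu] at h2 ⊢
      exact ptVec_orthogonal h1 h2
    · exact ⟨_, Projectivization.orthogonal_cross_left (hbx b hb),
        Projectivization.orthogonal_cross_right (hbx b hb), fun h => absurd h hb⟩
  choose line hl1 hl2 hl3 using hline
  refine ⟨⟨x, line, hl1, hl2⟩, ⟨hx, ?_⟩, rfl, hl3 a rfl⟩
  intro b c hc
  have h1 := orthogonal_frobPlane (k := k) (hl1 b)
  have h2 := orthogonal_frobPlane (k := k) (hl2 b)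
  rw [← hc] at h1
  rw [hx] at h2
  by_cases hb : b = a
  · subst hb
    have hcb : c = b := Subtype.ext (hc.trans haf)
    subst hcb
    have h3 := orthogonal_frobPlane (k := k) (hl3 c rfl)
    rw [hD] at h3
    exact eq_of_orthogonal haD (hl1 c) (hl3 c rfl) h1 h3
  · have hca : c ≠ a := by
      rintro rfl
      exact hb (Subtype.ext (frobPlane_injective (k := k) (hc.symm.trans haf.symm)))
    exact eq_of_orthogonal (hbx c hca) (hl1 c) (hl2 c) h1 h2

/-- Each line in the data of y passes through two distinct points that are determined by (d, w). -/
theorem Blowup.eq_of_hasParam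
    (ha : (a : ℙ K (Fin 3 → K)) = framePoint K M hM ![1, 0, 0] e0_ne_zero)
    (hZ : ∀ b ∈ Z, b ≠ a → frobPlane k b ≠ b) {d w : Option k} {y y' : Blowup Z}
    (h : y.HasParam M hM a d w) (h' : y'.HasParam M hM a d w) : y = y' := by
  have hpt := h.1.trans h'.1.symm
  refine Blowup.ext hpt (funext fun b => ?_)
  by_cases hb : b = a
  · subst hb
    refine eq_of_orthogonal ?_ (y.center_mem b) h.2 (y'.center_mem b) h'.2
    rw [ha]
    exact framePoint_e0_ne_dirVec hM d
  · refine eq_of_orthogonal ?_ (y.center_mem b) (y.pt_mem b) (y'.center_mem b)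
      (hpt ▸ y'.pt_mem b)
    intro hbx
    refine hZ b b.2 (fun h => hb (Subtype.ext h)) ?_
    rw [hbx, h.1]
    exact frobPlane_framePoint hM _

theorem Blowup.IsRational.exists_eq_mk_ofBase {y : Blowup Z} (hy : y.IsRational k)
    (haf : frobPlane k (a : ℙ K (Fin 3 → K)) = a) : ∃ u : Fin 3 → k, ∃ hu : u ≠ 0,
      y.line a = Projectivization.mk K (ofBase u) (ofBase_ne_zero K hu) :=
  exists_mk_ofBase (hy.2 a a haf.symm).symm

theorem Blowup.IsRational.hasParam_injective {y : Blowup Z} (hy : y.IsRational k)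
    (ha : (a : ℙ K (Fin 3 → K)) = framePoint K M hM ![1, 0, 0] e0_ne_zero)
    {d w d' w' : Option k}
    (h : y.HasParam M hM a d w) (h' : y.HasParam M hM a d' w') : d = d' ∧ w = w' := by
  obtain ⟨u, hu, hmu⟩ := hy.exists_eq_mk_ofBase (a := a) (by
    rw [ha]
    exact frobPlane_framePoint hM _)
  have h0 := y.center_mem a
  have h1 := h.2
  have h2 := h'.2
  rw [hmu, ha, framePoint_orthogonal_iff hM _ hu] at h0
  rw [hmu, framePoint_orthogonal_iff hM _ hu] at h1 h2
  have hd : d = d' := by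
    by_contra hne
    have hdet := dir_det_ne_zero hne
    apply hu
    refine Matrix.eq_zero_of_vecMul_eq_zero hM ?_
    simp only [dotProduct, Fin.sum_univ_three, dirVec, Matrix.cons_val] at h0 h1 h2
    ext i
    fin_cases i
    · simpa using h0
    · apply mul_left_cancel₀ hdet
      simp only [Fin.mk_one, Pi.zero_apply]
      linear_combination (dir d').2 * h1 - (dir d).2 * h2
    · apply mul_left_cancel₀ hdet
      simp only [Fin.reduceFinMk, Pi.zero_apply]
      linear_combination (dir d).1 * h2 - (dir d').1 * h1
  subst hd
  refine ⟨rfl, ?_⟩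
  have hpt := h.1.symm.trans h'.1
  rw [framePoint_eq_iff] at hpt
  obtain ⟨c, hc⟩ := hpt
  have hc0 := congrFun hc 0
  have hc1 := congrFun hc 1
  have hc2 := congrFun hc 2
  rcases w with _ | z <;> rcases w' with _ | z' <;>
    simp only [ptVec, Option.elim, Pi.smul_apply, Matrix.cons_val, smul_eq_mul] at hc0 hc1 hc2
  · rfl
  · rw [eq_zero_of_mul_dir hc1 hc2] at hc0
    simp at hc0
  · rcases dir_ne_zero d with h0 | h0
    · exact absurd (by simpa using hc1.symm) h0
    · exact absurd (by simpa using hc2.symm) h0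
  · have : c = 1 := sub_eq_zero.1 (eq_zero_of_mul_dir (d := d) (by linear_combination hc1)
      (by linear_combination hc2))
    rw [this, one_mul] at hc0
    rw [hc0]

theorem Blowup.IsRational.exists_hasParam {y : Blowup Z} (hy : y.IsRational k)
    (ha : (a : ℙ K (Fin 3 → K)) = framePoint K M hM ![1, 0, 0] e0_ne_zero) :
    ∃ d w, y.HasParam M hM a d w := by
  obtain ⟨u, hu, hmu⟩ := hy.exists_eq_mk_ofBase (a := a) (by
    rw [ha]
    exact frobPlane_framePoint hM _)
  obtain ⟨v, hv, hpv⟩ := exists_mk_ofBase hy.1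
  obtain ⟨x, hx, hxv⟩ := exists_framePoint_eq (K := K) hM hv
  rw [hxv] at hpv
  have h0 := y.center_mem a
  have h1 := y.pt_mem a
  rw [hmu, ha, framePoint_orthogonal_iff hM _ hu] at h0
  rw [hmu, hpv, framePoint_orthogonal_iff hM _ hu] at h1
  simp only [Blowup.HasParam, hmu, hpv, framePoint_orthogonal_iff hM (dirVec_ne_zero _) hu,
    framePoint_eq_iff]
  set b := Matrix.vecMul u M
  simp only [dotProduct, Fin.sum_univ_three, dirVec, Matrix.cons_val] at h0 h1 ⊢
  by_cases hx12 : x 1 = 0 ∧ x 2 = 0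
  -- Over P the direction is read off the line b₁ s + b₂ t = 0. Elsewhere it is that of the point.
  · obtain ⟨d, c, h2, h3⟩ := exists_eq_mul_dir (b 2) (-b 1)
    refine ⟨d, none, ⟨x 0, ?_⟩, ?_⟩
    · ext i
      fin_cases i <;> simp [ptVec, hx12]
    · by_cases hc : c = 0
      · simp only [hc, zero_mul, neg_eq_zero] at h2 h3
        simp [h2, h3]
      · apply mul_left_cancel₀ hc
        linear_combination (-b 1) * h2 + (-b 2) * h3
  · obtain ⟨d, c, h2, h3⟩ := exists_eq_mul_dir (x 1) (x 2)
    have hc : c ≠ 0 := by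
      rintro rfl
      exact hx12 ⟨by simpa using h2, by simpa using h3⟩
    refine ⟨d, some (x 0 / c), ⟨c, ?_⟩, ?_⟩
    · ext i
      fin_cases i
      · simp [ptVec, mul_div_cancel₀ _ hc]
      · simp [ptVec, h2]
      · simp [ptVec, h3]
    · apply mul_left_cancel₀ hc
      linear_combination h1 - x 0 * h0 - b 1 * h2 - b 2 * h3

end Frames

/-! ### Expansion of a quartic at a double point -/

section Quartics

/-- The binary form `∑ e i * s ^ i * t ^ (n - i)`. -/
def form {R : Type*} [CommRing R] (n : ℕ) (e : ℕ → R) (s t : R) : R :=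
  ∑ i ∈ Finset.range (n + 1), e i * s ^ i * t ^ (n - i)

theorem map_form {R S : Type*} [CommRing R] [CommRing S] (φ : R →+* S) (n : ℕ) (e : ℕ → R)
    (s t : R) : φ (form n e s t) = form n (fun i => φ (e i)) (φ s) (φ t) := by
  simp [form]

theorem form_mul {R : Type*} [CommRing R] (n : ℕ) (e : ℕ → R) (c s t : R) :
    form n e (c * s) (c * t) = c ^ n * form n e s t := by
  rw [form, form, Finset.mul_sum]
  refine Finset.sum_congr rfl fun i hi => ?_
  have : c ^ n = c ^ i * c ^ (n - i) := by
    rw [← pow_add, Nat.add_sub_cancel' (Nat.lt_succ_iff.1 (Finset.mem_range.1 hi))]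
  rw [this]
  ring

/-- Allows an identity obtained by cancelling a power of the variable to be evaluated at 0. -/
theorem eval_zero_of_forall_ne_zero {K : Type*} [Field K] [Infinite K] (p : Polynomial K)
    (h : ∀ x, x ≠ 0 → p.eval x = 0) : p.eval 0 = 0 := by
  have : Polynomial.X * p = 0 := Polynomial.funext fun x => by
    by_cases hx : x = 0
    · simp [hx]
    · simp [h x hx]
  rw [(mul_eq_zero.1 this).resolve_left Polynomial.X_ne_zero, Polynomial.eval_zero]

variable {k : Type*} [Field k] {K : Type*} [Field K] [Algebra k K]

variable (K) in
/-- The linear change of coordinates given by a matrix over `k`. -/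
def frameMap (M : Matrix (Fin 3) (Fin 3) k) : (Fin 3 → K) →ₗ[K] (Fin 3 → K) :=
  (M.map (algebraMap k K)).mulVecLin

theorem frameMap_ofBase (M : Matrix (Fin 3) (Fin 3) k) (v : Fin 3 → k) :
    frameMap K M (ofBase v) = ofBase (M.mulVec v) := by
  ext i
  simp [frameMap, ofBase, Matrix.mulVec, dotProduct]

theorem det_map_ne_zero {M : Matrix (Fin 3) (Fin 3) k} (hM : M.det ≠ 0) :
    (M.map (algebraMap k K)).det ≠ 0 := by
  have : (M.map (algebraMap k K)).det = algebraMap k K M.det :=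
    ((algebraMap k K).map_det M).symm
  rw [this]
  simpa using hM

theorem frameMap_injective {M : Matrix (Fin 3) (Fin 3) k} (hM : M.det ≠ 0) :
    Function.Injective (frameMap K M) :=
  Matrix.mulVec_injective_of_isUnit
    ((Matrix.isUnit_iff_isUnit_det _).2 (det_map_ne_zero hM).isUnit)

theorem frameMap_surjective {M : Matrix (Fin 3) (Fin 3) k} (hM : M.det ≠ 0) :
    Function.Surjective (frameMap K M) :=
  LinearMap.injective_iff_surjective.1 (frameMap_injective hM)

theorem exists_framePoint_rep {M : Matrix (Fin 3) (Fin 3) k} (hM : M.det ≠ 0) {v : Fin 3 → k}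
    (hv : v ≠ 0) : ∃ l : K, l ≠ 0 ∧
      (framePoint K M hM v hv).rep = l • frameMap K M (ofBase v) := by
  obtain ⟨l, hl⟩ := Projectivization.exists_smul_eq_mk_rep K _
    (ofBase_ne_zero K (mulVec_ne_zero hM hv))
  refine ⟨l, l.ne_zero, ?_⟩
  rw [frameMap_ofBase]
  exact hl.symm

theorem exists_quartic_coeff {g : MvPolynomial (Fin 3) k} (hg : g.IsHomogeneous 4) :
    ∃ e : ℕ → ℕ → k, ∀ x : Fin 3 → K, MvPolynomial.aeval x g =
      ∑ n ∈ Finset.range 5, x 0 ^ (4 - n) *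
        form n (fun i => algebraMap k K (e n i)) (x 1) (x 2) := by
  classical
  let D : (_ : ℕ) × ℕ → (Fin 3 →₀ ℕ) := fun p =>
    Finsupp.equivFunOnFinite.symm ![4 - p.1, p.2, p.1 - p.2]
  let S : Finset ((_ : ℕ) × ℕ) := (Finset.range 5).sigma fun n => Finset.range (n + 1)
  refine ⟨fun n i => g.coeff (D ⟨n, i⟩), fun x => ?_⟩
  have hD : Set.InjOn D S := by
    rintro ⟨n, i⟩ hp ⟨n', i'⟩ hp' h
    have h0 := DFunLike.congr_fun h 0
    have h1 := DFunLike.congr_fun h 1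
    simp only [S, Finset.coe_sigma, Set.mem_sigma_iff, Finset.mem_coe, Finset.mem_range] at hp hp'
    simp only [D, Finsupp.equivFunOnFinite_symm_apply_apply, Matrix.cons_val] at h0 h1
    obtain rfl : n = n' := by omega
    rw [h1]
  have hsub : g.support ⊆ S.image D := by
    intro d hd
    have hdeg := hg (MvPolynomial.mem_support_iff.1 hd)
    rw [Finsupp.weight_apply, Finsupp.sum_fintype _ _ (by simp), Fin.sum_univ_three] at hdeg
    simp only [Pi.one_apply, smul_eq_mul, mul_one] at hdeg
    refine Finset.mem_image.2 ⟨⟨d 1 + d 2, d 1⟩, ?_, ?_⟩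
    · simp only [S, Finset.mem_sigma, Finset.mem_range]
      omega
    · ext i
      fin_cases i
      · simp [D]; omega
      · simp [D]
      · simp [D]
  rw [MvPolynomial.aeval_def, MvPolynomial.eval₂_eq', Finset.sum_subset hsub (by
    intro d _ hd
    rw [MvPolynomial.notMem_support_iff.1 hd, map_zero, zero_mul]), Finset.sum_image hD,
    Finset.sum_sigma]
  refine Finset.sum_congr rfl fun n _ => ?_
  rw [form, Finset.mul_sum]
  refine Finset.sum_congr rfl fun i _ => ?_
  simp only [Fin.prod_univ_three, D, Finsupp.equivFunOnFinite_symm_apply_apply, Matrix.cons_val]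
  ring

theorem exists_aeval_frameMap (M : Matrix (Fin 3) (Fin 3) k) {f : MvPolynomial (Fin 3) k}
    (hf : f.IsHomogeneous 4) :
    ∃ e : ℕ → ℕ → k, ∀ x : Fin 3 → K, MvPolynomial.aeval (frameMap K M x) f =
      ∑ n ∈ Finset.range 5, x 0 ^ (4 - n) *
        form n (fun i => algebraMap k K (e n i)) (x 1) (x 2) := by
  let L : Fin 3 → MvPolynomial (Fin 3) k :=
    fun i => ∑ j, MvPolynomial.C (M i j) * MvPolynomial.X j
  have hL : ∀ i, (L i).IsHomogeneous 1 := fun i =>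
    MvPolynomial.IsHomogeneous.sum _ _ _ fun j _ => by
      simpa using (MvPolynomial.isHomogeneous_C (Fin 3) (M i j)).mul
        (MvPolynomial.isHomogeneous_X k j)
  have hg : (MvPolynomial.bind₁ L f).IsHomogeneous 4 := by
    simpa using hf.aeval L hL
  obtain ⟨e, he⟩ := exists_quartic_coeff (K := K) hg
  refine ⟨e, fun x => ?_⟩
  rw [← he x, MvPolynomial.aeval_bind₁]
  congr 2
  ext i
  simp [L, frameMap, Matrix.mulVec, dotProduct]

theorem eval_map_eq_aeval (f : MvPolynomial (Fin 3) k) (x : Fin 3 → K) :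
    MvPolynomial.eval x (MvPolynomial.map (algebraMap k K) f) = MvPolynomial.aeval x f := by
  rw [MvPolynomial.eval_map, MvPolynomial.aeval_def]

/-- The Taylor expansion of a quartic with a double point at `(1, 0, 0)`. -/
theorem exists_expansion_of_mult_two [Infinite K] {M : Matrix (Fin 3) (Fin 3) k} (hM : M.det ≠ 0)
    {f : MvPolynomial (Fin 3) k} (hf : f.IsHomogeneous 4)
    (hmult : HasMultAtLeast (MvPolynomial.map (algebraMap k K) f) 2
      (framePoint K M hM ![1, 0, 0] e0_ne_zero)) :
    ∃ A B C : ℕ → k, ∀ z s t : K, MvPolynomial.aeval (frameMap K M ![z, s, t]) f =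
      z ^ 2 * form 2 (fun i => algebraMap k K (A i)) s t +
      z * form 3 (fun i => algebraMap k K (B i)) s t +
      form 4 (fun i => algebraMap k K (C i)) s t := by
  obtain ⟨e, he⟩ := exists_aeval_frameMap (K := K) M hf
  obtain ⟨l, hl0, hl⟩ := exists_framePoint_rep (K := K) hM (e0_ne_zero (k := k))
  -- Restricted to a line through the representative of P in the affine cone, the generators of the
  -- maximal ideal become multiples of X, so f becomes a multiple of X². Hence the terms n = 0 and n
  -- = 1 vanish.
  have key : ∀ s t : K, ∃ h : Polynomial K, ∀ x : K,
      ∑ n ∈ Finset.range 5, l ^ (4 - n) *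
        (x ^ n * form n (fun i => algebraMap k K (e n i)) s t) = x ^ 2 * h.eval x := by
    intro s t
    let v : Fin 3 → K := frameMap K M ![0, s, t]
    let Φ : MvPolynomial (Fin 3) K →ₐ[K] Polynomial K := MvPolynomial.aeval fun i =>
      Polynomial.C ((framePoint K M hM ![1, 0, 0] e0_ne_zero).rep i) +
        Polynomial.X * Polynomial.C (v i)
    have hmem := Ideal.mem_map_of_mem Φ.toRingHom hmult
    rw [Ideal.map_pow, Ideal.map_span] at hmem
    have hle : Ideal.span (Φ.toRingHom '' Set.range fun i : Fin 3 =>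
        (MvPolynomial.X i - MvPolynomial.C ((framePoint K M hM ![1, 0, 0] e0_ne_zero).rep i) :
          MvPolynomial (Fin 3) K)) ≤ Ideal.span {Polynomial.X} := by
      rw [Ideal.span_le]
      rintro _ ⟨_, ⟨i, rfl⟩, rfl⟩
      simp only [AlgHom.toRingHom_eq_coe, RingHom.coe_coe, map_sub, SetLike.mem_coe,
        Ideal.mem_span_singleton]
      refine ⟨Polynomial.C (v i), ?_⟩
      simp [Φ]
    have hmem2 := Ideal.pow_right_mono hle 2 hmem
    rw [Ideal.span_singleton_pow, Ideal.mem_span_singleton] at hmem2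
    obtain ⟨h, hh⟩ := hmem2
    refine ⟨h, fun x => ?_⟩
    have hx := congrArg (Polynomial.eval x) hh
    have h1 : Polynomial.eval x (Φ (MvPolynomial.map (algebraMap k K) f)) =
        MvPolynomial.aeval (frameMap K M ![l, x * s, x * t]) f := by
      have h2 : frameMap K M ![l, x * s, x * t] = fun i =>
          (framePoint K M hM ![1, 0, 0] e0_ne_zero).rep i + x * v i := by
        have h3 : (![l, x * s, x * t] : Fin 3 → K) =
            l • ofBase (![1, 0, 0] : Fin 3 → k) + x • ![0, s, t] := by
          ext i
          fin_cases i <;> simp [ofBase]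
        rw [h3, map_add, map_smul, map_smul, ← hl]
        rfl
      rw [h2, ← eval_map_eq_aeval, ← Polynomial.coe_evalRingHom, ← RingHom.coe_coe Φ,
        ← RingHom.comp_apply]
      congr 1
      apply MvPolynomial.ringHom_ext
      · intro c
        simp [Φ]
      · intro i
        simp [Φ]
        ring
    have h4 : Polynomial.eval x (Φ.toRingHom (MvPolynomial.map (algebraMap k K) f)) =
        x ^ 2 * h.eval x := by
      rw [hx]
      simp
    rw [← h4]
    refine Eq.trans ?_ h1.symm
    rw [he]
    refine Finset.sum_congr rfl fun n _ => ?_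
    simp only [Matrix.cons_val]
    rw [form_mul]
  have h0 : ∀ s t : K, form 0 (fun i => algebraMap k K (e 0 i)) s t = 0 := by
    intro s t
    obtain ⟨h, hh⟩ := key s t
    have := hh 0
    simpa [Finset.sum_range_succ, hl0] using this
  have h1 : ∀ s t : K, form 1 (fun i => algebraMap k K (e 1 i)) s t = 0 := by
    intro s t
    obtain ⟨h, hh⟩ := key s t
    have := eval_zero_of_forall_ne_zero
      (Polynomial.C (l ^ 3 * form 1 (fun i => algebraMap k K (e 1 i)) s t) +
        Polynomial.X * (Polynomial.C (l ^ 2 * form 2 (fun i => algebraMap k K (e 2 i)) s t) +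
        Polynomial.X * Polynomial.C (l * form 3 (fun i => algebraMap k K (e 3 i)) s t) +
        Polynomial.X ^ 2 * Polynomial.C (form 4 (fun i => algebraMap k K (e 4 i)) s t) - h))
      (by
        intro x hx
        have h2 := hh x
        simp only [Finset.sum_range_succ, Finset.sum_range_zero, h0] at h2
        apply mul_left_cancel₀ hx
        simp only [Polynomial.eval_add, Polynomial.eval_sub, Polynomial.eval_mul,
          Polynomial.eval_C, Polynomial.eval_X, Polynomial.eval_pow]
        linear_combination h2)
    simpa [hl0] using this
  refine ⟨e 2, e 3, e 4, fun z s t => ?_⟩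
  rw [he]
  simp only [Finset.sum_range_succ, Finset.sum_range_zero, Matrix.cons_val, h0, h1]
  ring

end Quartics

/-! ### Equations of the residual curve in the coordinates (d, w) -/

section Membership

variable {k : Type*} [Field k] {K : Type*} [Field K] [Algebra k K]

theorem ofBase_vec3 (z s t : k) : (ofBase ![z, s, t] : Fin 3 → K) =
    ![algebraMap k K z, algebraMap k K s, algebraMap k K t] := by
  ext i
  fin_cases i <;> rfl

theorem exists_eq_mul_dir_of_det_eq_zero {d : Option k} {s t : K}
    (h : s * algebraMap k K (dir d).2 - t * algebraMap k K (dir d).1 = 0) :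
    ∃ c : K, s = c * algebraMap k K (dir d).1 ∧ t = c * algebraMap k K (dir d).2 := by
  rcases d with _ | x
  · exact ⟨t, by simpa using h, by simp⟩
  · exact ⟨s, by simp, by simp at h ⊢; linear_combination -h⟩

theorem framePoint_ptVec_notMem [Fintype k] {Z : Set (ℙ K (Fin 3 → K))}
    {M : Matrix (Fin 3) (Fin 3) k} {hM : M.det ≠ 0} {a : Z}
    (ha : (a : ℙ K (Fin 3 → K)) = framePoint K M hM ![1, 0, 0] e0_ne_zero)
    (hZ : ∀ b ∈ Z, b ≠ a → frobPlane k b ≠ b) (d : Option k) (z : k) :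
    framePoint K M hM (ptVec d (some z)) (ptVec_ne_zero d (some z)) ∉ Z := by
  intro hmem
  by_cases h : framePoint K M hM (ptVec d (some z)) (ptVec_ne_zero d (some z)) = a
  · rw [ha, framePoint_eq_iff] at h
    obtain ⟨c, hc⟩ := h
    have h1 := congrFun hc 1
    have h2 := congrFun hc 2
    simp only [ptVec, Option.elim, Pi.smul_apply, Matrix.cons_val, smul_eq_mul, mul_zero] at h1 h2
    rcases dir_ne_zero d with h0 | h0
    · exact h0 h1.symm
    · exact h0 h2.symm
  · exact hZ _ hmem h (frobPlane_framePoint hM _)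

theorem eval_mul_of_isHomogeneous {σ R : Type*} [CommRing R] {n : ℕ} {f : MvPolynomial σ R}
    (hf : f.IsHomogeneous n) (l : R) (x : σ → R) :
    MvPolynomial.eval (fun i => l * x i) f = l ^ n * MvPolynomial.eval x f := by
  rw [MvPolynomial.eval_eq, MvPolynomial.eval_eq, Finset.mul_sum]
  refine Finset.sum_congr rfl fun d hd => ?_
  have hdeg : ∑ i ∈ d.support, d i = n := by
    have := hf (MvPolynomial.mem_support_iff.1 hd)
    simpa [Finsupp.weight_apply, Finsupp.sum] using this
  simp only [mul_pow, Finset.prod_mul_distrib, Finset.prod_pow_eq_pow_sum, hdeg]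
  ring

theorem eval_framePoint_rep_eq_zero_iff {M : Matrix (Fin 3) (Fin 3) k} (hM : M.det ≠ 0)
    {v : Fin 3 → k} (hv : v ≠ 0) {n : ℕ} {f : MvPolynomial (Fin 3) k} (hf : f.IsHomogeneous n) :
    MvPolynomial.eval (framePoint K M hM v hv).rep (MvPolynomial.map (algebraMap k K) f) = 0 ↔
      MvPolynomial.aeval (frameMap K M (ofBase v)) f = 0 := by
  obtain ⟨l, hl0, hl⟩ := exists_framePoint_rep (K := K) hM hv
  rw [hl, ← eval_map_eq_aeval,
    show l • frameMap K M (ofBase v) = fun i => l * frameMap K M (ofBase v) i from rfl,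
    eval_mul_of_isHomogeneous (hf.map (algebraMap k K))]
  simp [hl0]

/-- The equations of the curve `π^* B - 2 E - F` in the coordinates `(d, w)` of its rational
points. -/
theorem eq_zero_of_mem_residualCurve [Fintype k] [Infinite K] {Z : Set (ℙ K (Fin 3 → K))}
    {M : Matrix (Fin 3) (Fin 3) k} {hM : M.det ≠ 0} {a : Z}
    (ha : (a : ℙ K (Fin 3 → K)) = framePoint K M hM ![1, 0, 0] e0_ne_zero)
    (hZ : ∀ b ∈ Z, b ≠ a → frobPlane k b ≠ b) {μ : ℙ K (Fin 3 → K) → ℕ} (hμ : μ a = 2)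
    {f : MvPolynomial (Fin 3) k} (hf : f.IsHomogeneous 4) {A B C : ℕ → k}
    (hABC : ∀ z s t : K, MvPolynomial.aeval (frameMap K M ![z, s, t]) f =
      z ^ 2 * form 2 (fun i => algebraMap k K (A i)) s t +
      z * form 3 (fun i => algebraMap k K (B i)) s t +
      form 4 (fun i => algebraMap k K (C i)) s t)
    {y : Blowup Z} {d w : Option k} (hy : y.HasParam M hM a d w)
    (hmem : y ∈ residualCurve Z μ (MvPolynomial.map (algebraMap k K) f)) :
    w.elim (form 2 A (dir d).1 (dir d).2) (fun z => z ^ 2 * form 2 A (dir d).1 (dir d).2 +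
      z * form 3 B (dir d).1 (dir d).2 + form 4 C (dir d).1 (dir d).2) = 0 := by
  rcases w with _ | z
  · have hya : y.pt = a := by
      rw [hy.1, ha]
      rfl
    rcases hmem with ⟨h, -⟩ | ⟨b, hb, G, hG, c, ⟨hc1, hc2, hc3, hc4⟩, hGc⟩
    · exact absurd a.2 (hya ▸ h)
    obtain rfl : a = b := Subtype.ext (hya.symm.trans hb)
    rw [hμ] at hG
    set v : Fin 3 → K := fun i => c (Sum.inr i) with hv
    set α := c (Sum.inl 0) with hα
    obtain ⟨l, hl0, hl⟩ := exists_framePoint_rep (K := K) hM (e0_ne_zero (k := k))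
    rw [← ha] at hl
    rw [LinearIndependent.pair_iff] at hc1
    have hβ : c (Sum.inl 1) = 0 ∧ α ≠ 0 := by
      obtain ⟨γ, hγ⟩ := (Projectivization.mk_eq_mk_iff' _ _ _ _ _).1
        (hc4.trans (hya.trans (Projectivization.mk_rep (a : ℙ K (Fin 3 → K))).symm))
      change γ • (a : ℙ K (Fin 3 → K)).rep = α • _ + c (Sum.inl 1) • v at hγ
      have h1 := hc1 (α - γ) (c (Sum.inl 1)) (by
        rw [sub_smul, hγ]
        abel)
      refine ⟨h1.2, fun h0 => hc3 ?_⟩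
      rw [h0, h1.2, zero_smul, zero_smul, add_zero]
    obtain ⟨hβ, hα0⟩ := hβ
    obtain ⟨x, hx⟩ := frameMap_surjective (K := K) hM v
    let u := (y.line a).rep
    have hu : u ≠ 0 := (y.line a).rep_nonzero
    let b := Matrix.vecMul u (M.map (algebraMap k K))
    have hdot : ∀ x', frameMap K M x' ⬝ᵥ u = x' ⬝ᵥ b := by
      intro x'
      rw [dotProduct_comm, dotProduct_comm x']
      exact Matrix.dotProduct_mulVec u _ x'
    have hb1 := y.center_mem a
    have hb2 := hy.2
    rw [ha, framePoint, ← Projectivization.mk_rep (y.line a), Projectivization.orthogonal_mk,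
      ← frameMap_ofBase, hdot, ofBase_vec3] at hb1
    rw [framePoint, ← Projectivization.mk_rep (y.line a), Projectivization.orthogonal_mk,
      ← frameMap_ofBase, hdot, dirVec, ofBase_vec3] at hb2
    rw [← hx, hdot] at hc2
    simp only [dotProduct, Fin.sum_univ_three, Matrix.cons_val, map_one, map_zero, one_mul,
      zero_mul, add_zero, zero_add] at hb1 hb2 hc2
    rw [hb1, mul_zero, zero_add] at hc2
    -- The vector v and the direction d lie on the same line through P, so modulo P they are
    -- proportional.
    have hdet : x 1 * algebraMap k K (dir d).2 - x 2 * algebraMap k K (dir d).1 = 0 := by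
      by_contra hne
      apply hu
      refine Matrix.eq_zero_of_vecMul_eq_zero (det_map_ne_zero hM) ?_
      ext i
      fin_cases i
      · exact hb1
      · change b 1 = 0
        apply mul_left_cancel₀ hne
        linear_combination algebraMap k K (dir d).2 * hc2 - x 2 * hb2
      · change b 2 = 0
        apply mul_left_cancel₀ hne
        linear_combination x 1 * hb2 - algebraMap k K (dir d).1 * hc2
    obtain ⟨e, he1, he2⟩ := exists_eq_mul_dir_of_det_eq_zero hdet
    have he : e ≠ 0 := by
      rintro rfl
      have h1 : v = (x 0 / l) • (a : ℙ K (Fin 3 → K)).rep := by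
        rw [hl, smul_smul, div_mul_cancel₀ _ hl0, ← map_smul, ← hx]
        congr 1
        ext i
        fin_cases i <;> simp [he1, he2, ofBase]
      have := hc1 (x 0 / l) (-1) (by rw [h1]; simp)
      simpa using this.2
    let σ : Fin 2 ⊕ Fin 3 → Polynomial K :=
      Sum.elim ![Polynomial.C α, Polynomial.X] fun i => Polynomial.C (v i)
    have hσ : ∀ (β : K) (Q : MvPolynomial (Fin 2 ⊕ Fin 3) K),
        Polynomial.eval β (MvPolynomial.aeval σ Q) =
          MvPolynomial.eval (Sum.elim ![α, β] v) Q := by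
      intro β Q
      rw [← Polynomial.coe_evalRingHom, ← RingHom.coe_coe (MvPolynomial.aeval σ),
        ← RingHom.comp_apply]
      congr 1
      apply MvPolynomial.ringHom_ext
      · intro r
        simp
      · rintro (i | i)
        · fin_cases i <;> simp [σ]
        · simp [σ]
    let s₀ := algebraMap k K (dir d).1
    let t₀ := algebraMap k K (dir d).2
    have hpull : ∀ β, MvPolynomial.eval (Sum.elim ![α, β] v)
        (pullback (a : ℙ K (Fin 3 → K)) (MvPolynomial.map (algebraMap k K) f)) =
        MvPolynomial.aeval (frameMap K M ![α * l + β * x 0, β * e * s₀, β * e * t₀]) f := by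
      intro β
      have h1 : frameMap K M ![α * l + β * x 0, β * e * s₀, β * e * t₀] =
          fun i => α * (a : ℙ K (Fin 3 → K)).rep i + β * v i := by
        have h2 : (![α * l + β * x 0, β * e * s₀, β * e * t₀] : Fin 3 → K) =
            α • l • ofBase (![1, 0, 0] : Fin 3 → k) + β • x := by
          ext i
          fin_cases i <;> simp [ofBase, he1, he2, s₀, t₀, mul_assoc]
        rw [h2, map_add, map_smul, map_smul, map_smul, ← hl, hx]
        rfl
      rw [h1, ← eval_map_eq_aeval, pullback, ← RingHom.coe_coe (MvPolynomial.aeval _),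
        ← RingHom.comp_apply]
      congr 1
      apply MvPolynomial.ringHom_ext
      · intro r
        simp
      · intro i
        simp
    -- For β ≠ 0 cancelling β² identifies G with this expansion. At β = 0 it gives G = (α l)² e²
    -- A(d), and α, l, e are nonzero.
    have hzero := eval_zero_of_forall_ne_zero (MvPolynomial.aeval σ G -
      ((Polynomial.C (α * l) + Polynomial.X * Polynomial.C (x 0)) ^ 2 *
        Polynomial.C (e ^ 2 * form 2 (fun i => algebraMap k K (A i)) s₀ t₀) +
      (Polynomial.C (α * l) + Polynomial.X * Polynomial.C (x 0)) * Polynomial.X *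
        Polynomial.C (e ^ 3 * form 3 (fun i => algebraMap k K (B i)) s₀ t₀) +
      Polynomial.X ^ 2 *
        Polynomial.C (e ^ 4 * form 4 (fun i => algebraMap k K (C i)) s₀ t₀))) (by
        intro β hβ0
        have h1 := congrArg (MvPolynomial.eval (Sum.elim ![α, β] v)) hG
        rw [hpull, hABC, form_mul, form_mul, form_mul] at h1
        simp only [map_mul, map_pow, MvPolynomial.eval_X, Sum.elim_inl, Matrix.cons_val] at h1
        simp only [Polynomial.eval_sub, Polynomial.eval_add, Polynomial.eval_mul,
          Polynomial.eval_pow, Polynomial.eval_C, Polynomial.eval_X, hσ]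
        apply mul_left_cancel₀ (pow_ne_zero 2 hβ0)
        linear_combination -h1)
    have hcc : (Sum.elim ![α, 0] v : Fin 2 ⊕ Fin 3 → K) = c := by
      ext (i | i)
      · fin_cases i
        · rfl
        · exact hβ.symm
      · rfl
    simp only [Polynomial.eval_sub, Polynomial.eval_add, Polynomial.eval_mul,
      Polynomial.eval_pow, Polynomial.eval_C, Polynomial.eval_X, hσ] at hzero
    rw [hcc, hGc] at hzero
    have hform : form 2 (fun i => algebraMap k K (A i)) s₀ t₀ = 0 := by
      have hne : (α * l) ^ 2 * e ^ 2 ≠ 0 := by positivity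
      apply mul_left_cancel₀ hne
      linear_combination -hzero
    rw [← map_form] at hform
    simpa using hform
  · have hnot := framePoint_ptVec_notMem ha hZ d z
    rcases hmem with ⟨-, h⟩ | ⟨b, hb, -⟩
    · rw [hy.1, eval_framePoint_rep_eq_zero_iff hM _ hf] at h
      simp only [ptVec, Option.elim, ofBase_vec3] at h
      rw [hABC, ← map_form, ← map_form, ← map_form, ← map_pow, ← map_mul, ← map_mul, ← map_add,
        ← map_add, map_eq_zero] at h
      exact h
    · rw [hy.1] at hb
      exact absurd b.2 (hb ▸ hnot)

end Membership

/-! ### Counting along the fibres -/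

section Counting

variable {k : Type*} [Field k]

/-- The values at the points of a projective line of the binary quadratic form with
coefficients `α, β, γ`. -/
def fiberEq (α β γ : k) (w : Option k) : k := w.elim α fun z => z ^ 2 * α + z * β + γ

theorem eq_zero_of_fiberEq {α β γ z₁ z₂ : k} (hz : z₁ ≠ z₂) (h : fiberEq α β γ none = 0)
    (h1 : fiberEq α β γ (some z₁) = 0) (h2 : fiberEq α β γ (some z₂) = 0) :
    α = 0 ∧ β = 0 ∧ γ = 0 := by
  simp only [fiberEq, Option.elim] at h h1 h2
  subst h
  have hβ : β = 0 := by
    apply mul_left_cancel₀ (sub_ne_zero.2 hz)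
    linear_combination h1 - h2
  subst hβ
  exact ⟨rfl, rfl, by simpa using h1⟩

open Classical in
theorem card_fiberEq_le [Fintype k] {α β γ : k} (h : ¬(α = 0 ∧ β = 0 ∧ γ = 0)) :
    (Finset.univ.filter fun w => fiberEq α β γ w = 0).card ≤ 2 := by
  by_contra! hlt
  obtain ⟨x, y, z, hx, hy, hz, hxy, hxz, hyz⟩ := Finset.two_lt_card_iff.1 hlt
  simp only [Finset.mem_filter, Finset.mem_univ, true_and] at hx hy hz
  rcases x with _ | x <;> rcases y with _ | y <;> rcases z with _ | z <;>
    simp only [ne_eq, not_true_eq_false, Option.some.injEq] at hxy hxz hyz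
  · exact h (eq_zero_of_fiberEq hyz hx hy hz)
  · exact h (eq_zero_of_fiberEq hxz hy hx hz)
  · exact h (eq_zero_of_fiberEq hxy hz hx hy)
  · have hα : α = 0 := by
      simp only [fiberEq, Option.elim] at hx hy hz
      have h1 : (x + y) * α + β = 0 := by
        apply mul_left_cancel₀ (sub_ne_zero.2 hxy)
        linear_combination hx - hy
      have h2 : (x + z) * α + β = 0 := by
        apply mul_left_cancel₀ (sub_ne_zero.2 hxz)
        linear_combination hx - hz
      apply mul_left_cancel₀ (sub_ne_zero.2 hyz)
      linear_combination h1 - h2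
    exact h (eq_zero_of_fiberEq hxy hα hx hy)

open Classical in
/-- If the equations of all fibres but one are nonzero, then each of these fibres has at most two
points, and there are at most `3 q + 3` points in all. -/
theorem card_fiberEq_pairs_le [Fintype k] (α β γ : Option k → k) (d₀ : Option k)
    (h : ∀ d, d ≠ d₀ → ¬(α d = 0 ∧ β d = 0 ∧ γ d = 0)) :
    (Finset.univ.filter fun p : Option k × Option k =>
      fiberEq (α p.1) (β p.1) (γ p.1) p.2 = 0).card ≤ 3 * Fintype.card k + 3 := by
  have h1 : (Finset.univ.filter fun p : Option k × Option k =>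
      fiberEq (α p.1) (β p.1) (γ p.1) p.2 = 0).card =
      ∑ d : Option k, (Finset.univ.filter fun w => fiberEq (α d) (β d) (γ d) w = 0).card := by
    simp only [Finset.card_filter, Fintype.sum_prod_type]
  rw [h1, ← Finset.add_sum_erase _ _ (Finset.mem_univ d₀)]
  -- The excepted fibre may be full; the total is still at most 3 q + 1.
  have h2 : (Finset.univ.filter fun w => fiberEq (α d₀) (β d₀) (γ d₀) w = 0).card ≤
      Fintype.card k + 1 := (Finset.card_le_univ _).trans (by simp)
  have h3 := Finset.sum_le_card_nsmul (Finset.univ.erase d₀)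
    (fun d => (Finset.univ.filter fun w => fiberEq (α d) (β d) (γ d) w = 0).card) 2
    (fun d hd => card_fiberEq_le (h d (Finset.ne_of_mem_erase hd)))
  rw [Finset.card_erase_of_mem (Finset.mem_univ _)] at h3
  simp only [Finset.card_univ, Fintype.card_option, Nat.add_sub_cancel, smul_eq_mul] at h3
  omega

variable {K : Type*} [Field K] [Algebra k K]

theorem eq_zero_of_forall_quadratic [Infinite K] {α β γ : K}
    (h : ∀ z : K, z ^ 2 * α + z * β + γ = 0) : α = 0 ∧ β = 0 ∧ γ = 0 := by
  classical
  have h0 := h 0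
  have h1 := h 1
  obtain ⟨x, hx⟩ := Infinite.exists_notMem_finset ({0, 1} : Finset K)
  simp only [Finset.mem_insert, Finset.mem_singleton, not_or] at hx
  have h2 := h x
  have hγ : γ = 0 := by simpa using h0
  subst hγ
  have hα : α = 0 := by
    apply mul_left_cancel₀ (mul_ne_zero hx.1 (sub_ne_zero.2 hx.2))
    linear_combination h2 - x * h1
  subst hα
  exact ⟨rfl, by simpa using h1, rfl⟩

open Classical in
theorem encard_rationalPoints_le [Fintype k] {Z : Set (ℙ K (Fin 3 → K))}
    {M : Matrix (Fin 3) (Fin 3) k} {hM : M.det ≠ 0} {a : Z}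
    (ha : (a : ℙ K (Fin 3 → K)) = framePoint K M hM ![1, 0, 0] e0_ne_zero)
    (hZ : ∀ b ∈ Z, b ≠ a → frobPlane k b ≠ b) {C : Set (Blowup Z)} {E : Option k → Option k → Prop}
    (hE : ∀ y ∈ C, ∀ d w, y.HasParam M hM a d w → E d w) :
    (rationalPoints k C).encard ≤
      ((Finset.univ.filter fun p : Option k × Option k => E p.1 p.2).card : ℕ∞) := by
  have hex : ∀ y : Blowup Z, ∃ p : Option k × Option k, y.IsRational k →
      y.HasParam M hM a p.1 p.2 := by
    intro y
    by_cases hy : y.IsRational k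
    · obtain ⟨d, w, h⟩ := hy.exists_hasParam ha
      exact ⟨(d, w), fun _ => h⟩
    · exact ⟨default, fun h => absurd h hy⟩
  choose g hg using hex
  rw [← Set.encard_coe_eq_coe_finsetCard]
  refine Set.encard_le_encard_of_injOn (f := g) ?_ ?_
  · rintro y ⟨hyC, hy⟩
    simpa using hE y hyC _ _ (hg y hy)
  · rintro y ⟨-, hy⟩ y' ⟨-, hy'⟩ h
    exact Blowup.eq_of_hasParam ha hZ (hg y hy) (h ▸ hg y' hy')

end Counting

/-! ### Curves containing two fibres -/

section UpperBound

variable {k : Type*} [Field k] {K : Type*} [Field K] [Algebra k K]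

theorem eq_zero_of_aeval_frameMap [Infinite K] {M : Matrix (Fin 3) (Fin 3) k} (hM : M.det ≠ 0)
    {f : MvPolynomial (Fin 3) k}
    (h : ∀ z s t : K, MvPolynomial.aeval (frameMap K M ![z, s, t]) f = 0) : f = 0 := by
  apply MvPolynomial.map_injective _ (algebraMap k K).injective
  rw [map_zero]
  refine MvPolynomial.funext fun x => ?_
  obtain ⟨y, rfl⟩ := frameMap_surjective (K := K) hM x
  rw [eval_map_eq_aeval, map_zero, ← h (y 0) (y 1) (y 2)]
  congr 2

/-- Taking the two directions as basis vectors turns the lines d₁ and d₂ into t = 0 and s = 0. -/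
theorem exists_frame_through {M : Matrix (Fin 3) (Fin 3) k} (hM : M.det ≠ 0) {d₁ d₂ : Option k}
    (hd : d₁ ≠ d₂) : ∃ M' : Matrix (Fin 3) (Fin 3) k, M'.det ≠ 0 ∧
      M'.mulVec ![1, 0, 0] = M.mulVec ![1, 0, 0] ∧
      ∀ z s t : K, frameMap K M' ![z, s, t] = frameMap K M ![z,
        s * algebraMap k K (dir d₁).1 + t * algebraMap k K (dir d₂).1,
        s * algebraMap k K (dir d₁).2 + t * algebraMap k K (dir d₂).2] := by
  let N : Matrix (Fin 3) (Fin 3) k :=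
    !![1, 0, 0; 0, (dir d₁).1, (dir d₂).1; 0, (dir d₁).2, (dir d₂).2]
  have hN : N.det ≠ 0 := by
    have := dir_det_ne_zero hd
    intro h
    apply this
    simp only [N, Matrix.det_fin_three, Matrix.of_apply, Matrix.cons_val] at h
    linear_combination h
  refine ⟨M * N, ?_, ?_, ?_⟩
  · rw [Matrix.det_mul]
    exact mul_ne_zero hM hN
  · rw [← Matrix.mulVec_mulVec]
    congr 1
    ext i
    fin_cases i <;> simp [N, Matrix.mulVec, dotProduct, Fin.sum_univ_three]
  · intro z s t
    simp only [frameMap, Matrix.map_mul, Matrix.mulVecLin_apply, ← Matrix.mulVec_mulVec]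
    congr 1
    ext i
    fin_cases i <;> simp [N, Matrix.mulVec, dotProduct, Fin.sum_univ_three, mul_comm]

variable [Fintype k] [Infinite K] {Z : Set (ℙ K (Fin 3 → K))} {μ : ℙ K (Fin 3 → K) → ℕ}
  {f : MvPolynomial (Fin 3) k} {a : Z} {θ ζ : K}

/-- The form is s t times a conic through r. The two fibres carry 2 (q + 1) points; the rest lie on
the conic away from P if its z² coefficient is nonzero, and on the exceptional curve if it is zero.
-/
theorem encard_le_of_two_fibers {M : Matrix (Fin 3) (Fin 3) k} {hM : M.det ≠ 0}
    (ha : (a : ℙ K (Fin 3 → K)) = framePoint K M hM ![1, 0, 0] e0_ne_zero)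
    (hZ : ∀ b ∈ Z, b ≠ a → frobPlane k b ≠ b) (hμ : μ a = 2)
    (hf : f.IsHomogeneous 4) (hf0 : f ≠ 0)
    (hmult : HasMultAtLeast (MvPolynomial.map (algebraMap k K) f) 2 (a : ℙ K (Fin 3 → K)))
    (hθ : frob k K θ ≠ θ) (hθ' : frob k K (frob k K θ) = θ) (hζ : frob k K (frob k K ζ) ≠ ζ)
    (hr : MvPolynomial.aeval (frameMap K M ![ζ, θ, 1]) f = 0)
    (h₁ : ∀ z : K, MvPolynomial.aeval (frameMap K M ![z, 1, 0]) f = 0)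
    (h₂ : ∀ z : K, MvPolynomial.aeval (frameMap K M ![z, 0, 1]) f = 0) :
    (rationalPoints k (residualCurve Z μ (MvPolynomial.map (algebraMap k K) f))).encard ≤
      ((3 * Fintype.card k + 3 : ℕ) : ℕ∞) := by
  classical
  rw [ha] at hmult
  obtain ⟨A, B, C, hABC⟩ := exists_expansion_of_mult_two hM hf hmult
  have hcoef₁ := eq_zero_of_forall_quadratic fun z => (hABC z 1 0).symm.trans (h₁ z)
  have hcoef₂ := eq_zero_of_forall_quadratic fun z => (hABC z 0 1).symm.trans (h₂ z)
  simp [form, Finset.sum_range_succ] at hcoef₁ hcoef₂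
  obtain ⟨hA2, hB3, hC4⟩ := hcoef₁
  obtain ⟨hA0, hB0, hC0⟩ := hcoef₂
  have hform : ∀ z s t : K, MvPolynomial.aeval (frameMap K M ![z, s, t]) f = s * t *
      conic (algebraMap k K (A 1)) (algebraMap k K (B 2)) (algebraMap k K (B 1))
        (algebraMap k K (C 3)) (algebraMap k K (C 2)) (algebraMap k K (C 1)) z s t := by
    intro z s t
    rw [hABC]
    simp only [form, conic, Finset.sum_range_succ, Finset.sum_range_zero, hA0, hA2, hB0, hB3,
      hC0, hC4, map_zero]
    ring
  have hθ0 : θ ≠ 0 := by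
    rintro rfl
    exact hθ (map_zero _)
  rw [hform, mul_one, mul_eq_zero, or_iff_right hθ0] at hr
  let E : Option k → Option k → Prop := fun d w =>
    w.elim ((dir d).1 * (dir d).2 * A 1 = 0) fun z =>
      (dir d).1 * (dir d).2 * conic (A 1) (B 2) (B 1) (C 3) (C 2) (C 1) z
        (dir d).1 (dir d).2 = 0
  have hE : ∀ y ∈ residualCurve Z μ (MvPolynomial.map (algebraMap k K) f), ∀ d w,
      y.HasParam M hM a d w → E d w := by
    intro y hy d w hdw
    have := eq_zero_of_mem_residualCurve ha hZ hμ hf hABC hdw hy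
    rcases w with _ | z
    · simp only [Option.elim, form, Finset.sum_range_succ, Finset.sum_range_zero, hA0, hA2] at this
      simp only [E, Option.elim]
      linear_combination this
    · simp only [Option.elim, form, Finset.sum_range_succ, Finset.sum_range_zero, hA0, hA2, hB0,
        hB3, hC0, hC4] at this
      simp only [E, Option.elim, conic]
      linear_combination this
  refine (encard_rationalPoints_le ha hZ hE).trans (Nat.cast_le.2 ?_)
  let S₁ : Finset (Option k × Option k) := {some 0, none} ×ˢ Finset.univ
  have hS₁ : S₁.card ≤ 2 * (Fintype.card k + 1) := by
    rw [Finset.card_product]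
    simp
  have hdir : ∀ d : Option k, d ≠ some 0 → d ≠ none → (dir d).1 * (dir d).2 ≠ 0 := by
    intro d h h'
    rcases d with _ | x
    · exact absurd rfl h'
    · simpa using h
  by_cases hc : A 1 = 0
  · have hr' := congrArg (fun x => frob k K (frob k K x)) hr
    simp only [frob_conic, hθ', map_one, map_zero] at hr'
    simp only [hc, conic, map_zero] at hr hr'
    -- The equations at ζ and φ² ζ differ by (φ² ζ - ζ) times this linear form.
    have hL : algebraMap k K (B 2) * θ + algebraMap k K (B 1) = 0 := by
      apply mul_left_cancel₀ (sub_ne_zero.2 hζ)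
      linear_combination hr' - hr
    obtain ⟨hB2, hB1⟩ := eq_zero_of_mul_add_eq_zero hθ hL
    rw [hB2, hB1] at hr
    have hQ : ∀ x : k, x ≠ 0 → C 3 + C 2 * x + C 1 * x ^ 2 ≠ 0 := by
      intro x hx h
      have h' := congrArg (algebraMap k K) h
      simp only [map_add, map_mul, map_pow, map_zero] at h' hr
      have hxθ : algebraMap k K x * θ + algebraMap k K (-1) ≠ 0 :=
        fun h0 => hx (eq_zero_of_mul_add_eq_zero hθ h0).1
      -- For the remaining binary form Q, the difference x² Q(θ, 1) - Q(1, x) has the nonzero factor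
      -- xθ - 1. The cofactor is linear in θ, which forces Q = 0 and then f = 0.
      have h3 : algebraMap k K (C 3 * x) * θ + algebraMap k K (C 3 + C 2 * x) = 0 := by
        apply mul_left_cancel₀ hxθ
        simp only [map_add, map_mul, map_neg, map_one]
        linear_combination algebraMap k K x ^ 2 * hr - h'
      obtain ⟨h4, h5⟩ := eq_zero_of_mul_add_eq_zero hθ h3
      have hC3 : C 3 = 0 := (mul_eq_zero.1 h4).resolve_right hx
      have hC2 : C 2 = 0 := by simpa [hC3, hx] using h5
      have hC1 : C 1 = 0 := by simpa [hC3, hC2, hx] using h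
      apply hf0
      apply eq_zero_of_aeval_frameMap (K := K) hM
      intro z s t
      rw [hform]
      simp [hc, hB1, hB2, hC1, hC2, hC3, conic]
    have hsub : (Finset.univ.filter fun p : Option k × Option k => E p.1 p.2) ⊆
        S₁ ∪ Finset.univ ×ˢ {none} := by
      rintro ⟨d, w⟩ hp
      simp only [Finset.mem_filter, Finset.mem_univ, true_and] at hp
      simp only [S₁, Finset.mem_union, Finset.mem_product, Finset.mem_insert,
        Finset.mem_singleton, Finset.mem_univ, and_true, true_and]
      by_contra! hcon
      obtain ⟨⟨hd1, hd2⟩, hw⟩ := hcon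
      rcases w with _ | z
      · exact hw rfl
      · simp only [E, Option.elim] at hp
        have := (mul_eq_zero.1 hp).resolve_left (hdir d hd1 hd2)
        rcases d with _ | x
        · exact hd2 rfl
        · refine hQ x (by simpa using hd1) ?_
          simp only [conic, hc, hB1, hB2, dir_some] at this
          linear_combination this
    refine (Finset.card_le_card hsub).trans ((Finset.card_union_le _ _).trans ?_)
    rw [Finset.card_product (Finset.univ : Finset (Option k))]
    simp only [Finset.card_univ, Fintype.card_option, Finset.card_singleton]
    omega
  · let S₂ : Finset (Option k × k) := Finset.univ.filter fun p =>
      conic (A 1) (B 2) (B 1) (C 3) (C 2) (C 1) p.2 (dir p.1).1 (dir p.1).2 = 0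
    have hS₂ : S₂.card ≤ Fintype.card k + 1 := by
      have := card_conic_le (A 1) (B 2) (B 1) (C 3) (C 2) (C 1) hc hθ'
        (conic_ne_zero_of_frob_frob_eq _ _ _ _ _ _ hc hθ' hζ hr)
      rwa [Nat.card_eq_fintype_card, Fintype.card_subtype] at this
    have hsub : (Finset.univ.filter fun p : Option k × Option k => E p.1 p.2) ⊆
        S₁ ∪ S₂.image fun p => (p.1, some p.2) := by
      rintro ⟨d, w⟩ hp
      simp only [Finset.mem_filter, Finset.mem_univ, true_and] at hp
      by_cases hd : d = some 0 ∨ d = none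
      · refine Finset.mem_union_left _ ?_
        simpa [S₁] using hd
      · rw [not_or] at hd
        have hd' := hdir d hd.1 hd.2
        rcases w with _ | z
        · simp only [E, Option.elim] at hp
          exact absurd hp (mul_ne_zero hd' hc)
        · simp only [E, Option.elim] at hp
          refine Finset.mem_union_right _ (Finset.mem_image.2 ⟨(d, z), ?_, rfl⟩)
          simpa [S₂] using (mul_eq_zero.1 hp).resolve_left hd'
    refine (Finset.card_le_card hsub).trans ((Finset.card_union_le _ _).trans ?_)
    have := Finset.card_image_le (s := S₂) (f := fun p => (p.1, some p.2))
    omega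

end UpperBound

/-! ### Coordinates of the point of degree 4 -/

section Coordinates

variable {k : Type*} [Field k] [Fintype k] {K : Type*} [Field K] [Algebra k K]

theorem frobVec_frameMap (M : Matrix (Fin 3) (Fin 3) k) (x : Fin 3 → K) :
    frobVec k K (frameMap K M x) = frameMap K M (frobVec k K x) := by
  ext i
  simp [frobVec, frameMap, Matrix.mulVec, dotProduct]

theorem frobVec_vecMul (M : Matrix (Fin 3) (Fin 3) k) (u : Fin 3 → K) :
    frobVec k K (Matrix.vecMul u (M.map (algebraMap k K))) =
      Matrix.vecMul (frobVec k K u) (M.map (algebraMap k K)) := by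
  ext i
  simp [frobVec, Matrix.vecMul, dotProduct]

/-- A point of degree `4` on a line of degree `2` through the rational point `(1, 0, 0)`. -/
theorem exists_coordinates {M : Matrix (Fin 3) (Fin 3) k} {hM : M.det ≠ 0}
    {m r : ℙ K (Fin 3 → K)}
    (hm : frobPlane k m ≠ m) (hm' : frobPlane k (frobPlane k m) = m)
    (hPm : (framePoint K M hM ![1, 0, 0] e0_ne_zero).orthogonal m)
    (hr : frobPlane k (frobPlane k r) ≠ r)
    (hr' : frobPlane k (frobPlane k (frobPlane k (frobPlane k r))) = r)
    (hrm : r.orthogonal m) :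
    ∃ θ ζ : K, frob k K θ ≠ θ ∧ frob k K (frob k K θ) = θ ∧ frob k K (frob k K ζ) ≠ ζ ∧
      frob k K (frob k K (frob k K (frob k K ζ))) = ζ ∧
      ∃ h : frameMap K M ![ζ, θ, 1] ≠ 0, r = Projectivization.mk K _ h := by
  induction m with | h u hu =>
  induction r with | h v hv =>
  obtain ⟨x, rfl⟩ := frameMap_surjective (K := K) hM v
  -- In the frame, m is b₁ s + b₂ t = 0, so θ = -b₂ / b₁ is the ratio s / t on m. Scaling r to t = 1
  -- gives (ζ, θ, 1); t = 0 would make r the rational point P.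
  let b := Matrix.vecMul u (M.map (algebraMap k K))
  have hdot : ∀ x', frameMap K M x' ⬝ᵥ u = x' ⬝ᵥ b := by
    intro x'
    rw [dotProduct_comm, dotProduct_comm x']
    exact Matrix.dotProduct_mulVec u _ x'
  have hinj : Function.Injective fun u : Fin 3 → K =>
      Matrix.vecMul u (M.map (algebraMap k K)) :=
    Matrix.vecMul_injective_of_isUnit
      ((Matrix.isUnit_iff_isUnit_det _).2 (det_map_ne_zero hM).isUnit)
  rw [framePoint, Projectivization.orthogonal_mk, ← frameMap_ofBase, hdot, ofBase_vec3] at hPm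
  rw [Projectivization.orthogonal_mk, hdot] at hrm
  simp only [dotProduct, Fin.sum_univ_three, Matrix.cons_val, map_one, map_zero, one_mul,
      zero_mul, add_zero] at hPm hrm
  rw [hPm, mul_zero, zero_add] at hrm
  have hbu : ∀ c : K, frobVec k K b = c • b → False := by
    intro c hc
    apply hm
    rw [frobPlane_mk, Projectivization.mk_eq_mk_iff']
    refine ⟨c, hinj ?_⟩
    simp only [Matrix.smul_vecMul, ← frobVec_vecMul]
    exact hc.symm
  have hb2 : ∃ c : K, c • b = frobVec k K (frobVec k K b) := by
    rw [frobPlane_mk, frobPlane_mk, Projectivization.mk_eq_mk_iff'] at hm'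
    obtain ⟨c, hc⟩ := hm'
    refine ⟨c, ?_⟩
    simp only [b, frobVec_vecMul, ← Matrix.smul_vecMul, hc]
  have hb1 : b 1 ≠ 0 := by
    intro h
    apply hbu (frob k K (b 2) / b 2)
    by_cases h2 : b 2 = 0
    · ext i
      fin_cases i <;> simp [frobVec, hPm, h, h2]
    · ext i
      fin_cases i <;> simp [frobVec, hPm, h, h2]
  have hθ : frob k K (-b 2 / b 1) ≠ -b 2 / b 1 := by
    intro h
    apply hbu (frob k K (b 1) / b 1)
    have h1 : frob k K (b 1) ≠ 0 := by simpa using hb1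
    rw [map_div₀, map_neg, div_eq_div_iff h1 hb1] at h
    ext i
    fin_cases i
    · simp [frobVec, hPm]
    · simp [frobVec, hb1]
    · change frob k K (b 2) = frob k K (b 1) / b 1 * b 2
      rw [div_mul_eq_mul_div, eq_div_iff hb1]
      linear_combination -h
  have hθ' : frob k K (frob k K (-b 2 / b 1)) = -b 2 / b 1 := by
    obtain ⟨c, hc⟩ := hb2
    have h1 : c * b 1 = frob k K (frob k K (b 1)) := congrFun hc 1
    have h2 : c * b 2 = frob k K (frob k K (b 2)) := congrFun hc 2
    have hc0 : c ≠ 0 := by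
      rintro rfl
      rw [zero_mul, eq_comm, map_eq_zero, map_eq_zero] at h1
      exact hb1 h1
    simp only [map_div₀, map_neg]
    rw [← h1, ← h2, ← mul_neg, mul_div_mul_left _ _ hc0]
  have hx2 : x 2 ≠ 0 := by
    intro h2
    have h1 : x 1 = 0 := by simpa [h2, hb1] using hrm
    apply hr
    have hfix : frobPlane k (Projectivization.mk K _ hv) = Projectivization.mk K _ hv := by
      have hx0 : x 0 ≠ 0 := by
        intro h0
        apply hv
        rw [show x = 0 by ext i; fin_cases i <;> assumption, map_zero]
      rw [frobPlane_mk, Projectivization.mk_eq_mk_iff']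
      refine ⟨frob k K (x 0) / x 0, ?_⟩
      rw [frobVec_frameMap, ← map_smul]
      congr 1
      ext i
      fin_cases i
      · simp [frobVec, hx0]
      · simp [frobVec, h1]
      · simp [frobVec, h2]
    rw [hfix, hfix]
  have hne : frameMap K M ![x 0 / x 2, -b 2 / b 1, 1] ≠ 0 := by
    rw [← map_zero (frameMap K M)]
    refine (frameMap_injective hM).ne fun h => ?_
    simpa using congrFun h 2
  have hreq : Projectivization.mk K _ hv = Projectivization.mk K _ hne := by
    rw [Projectivization.mk_eq_mk_iff']
    refine ⟨x 2, ?_⟩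
    rw [← map_smul]
    congr 1
    ext i
    fin_cases i
    · simp [mul_div_cancel₀ _ hx2]
    · simp only [Fin.mk_one, Pi.smul_apply, Matrix.cons_val, smul_eq_mul]
      rw [mul_div_assoc', div_eq_iff hb1]
      linear_combination -hrm
    · simp
  have hfrob : ∀ z s : K, frobVec k K ![z, s, 1] = ![frob k K z, frob k K s, 1] := by
    intro z s
    ext i
    fin_cases i <;> simp [frobVec]
  refine ⟨_, x 0 / x 2, hθ, hθ', ?_, ?_, hne, hreq⟩
  · intro h
    apply hr
    rw [hreq]
    simp only [frobPlane_mk, frobVec_frameMap, hfrob, h, hθ']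
  · rw [hreq] at hr'
    simp only [frobPlane_mk, frobVec_frameMap, hfrob, hθ', Projectivization.mk_eq_mk_iff'] at hr'
    obtain ⟨c, hc⟩ := hr'
    rw [← map_smul] at hc
    have hc := frameMap_injective hM hc
    have h2 := congrFun hc 2
    have h0 := congrFun hc 0
    simp only [Pi.smul_apply, Matrix.cons_val, smul_eq_mul, mul_one] at h0 h2
    rw [← h0, h2, one_mul]

end Coordinates

theorem aeval_eq_zero_of_hasMultAtLeast_one {k K : Type*} [Field k] [Field K] [Algebra k K]
    {f : MvPolynomial (Fin 3) k} {b : ℙ K (Fin 3 → K)} {n : ℕ}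
    (hf : f.IsHomogeneous n)
    (h : HasMultAtLeast (MvPolynomial.map (algebraMap k K) f) 1 b) {v : Fin 3 → K} (hv : v ≠ 0)
    (hb : b = Projectivization.mk K v hv) : MvPolynomial.aeval v f = 0 := by
  rw [HasMultAtLeast, pow_one] at h
  have hle : Ideal.span (Set.range fun i : Fin 3 =>
      (MvPolynomial.X i - MvPolynomial.C (b.rep i) : MvPolynomial (Fin 3) K)) ≤
      RingHom.ker (MvPolynomial.eval b.rep) := by
    rw [Ideal.span_le]
    rintro _ ⟨i, rfl⟩
    simp [RingHom.mem_ker]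
  have h0 : MvPolynomial.eval b.rep (MvPolynomial.map (algebraMap k K) f) = 0 := hle h
  obtain ⟨c, hc⟩ := Projectivization.exists_smul_eq_mk_rep K v hv
  rw [hb, ← hc, show c • v = fun i => (c : K) * v i from rfl,
    eval_mul_of_isHomogeneous (hf.map (algebraMap k K)), mul_eq_zero,
    or_iff_right (pow_ne_zero n c.ne_zero), eval_map_eq_aeval] at h0
  exact h0

/-! ### The upper bound for all members -/

section Bound

variable {k : Type*} [Field k] [Fintype k] {K : Type*} [Field K] [Algebra k K] [Infinite K]
  {Z : Set (ℙ K (Fin 3 → K))} {μ : ℙ K (Fin 3 → K) → ℕ} {a : Z}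

theorem encard_rationalPoints_residualCurve_le {M : Matrix (Fin 3) (Fin 3) k} {hM : M.det ≠ 0}
    (ha : (a : ℙ K (Fin 3 → K)) = framePoint K M hM ![1, 0, 0] e0_ne_zero)
    (hZ : ∀ b ∈ Z, b ≠ a → frobPlane k b ≠ b) (hμ : μ a = 2)
    {m r : ℙ K (Fin 3 → K)} (hrZ : r ∈ Z) (hμr : μ r = 1)
    (hm : frobPlane k m ≠ m) (hm' : frobPlane k (frobPlane k m) = m)
    (hPm : (a : ℙ K (Fin 3 → K)).orthogonal m)
    (hr : frobPlane k (frobPlane k r) ≠ r)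
    (hr' : frobPlane k (frobPlane k (frobPlane k (frobPlane k r))) = r)
    (hrm : r.orthogonal m) {f : MvPolynomial (Fin 3) k} (hf : f ∈ planeSystem k 4 Z μ) :
    (rationalPoints k (residualCurve Z μ (MvPolynomial.map (algebraMap k K) f))).encard ≤
      ((3 * Fintype.card k + 3 : ℕ) : ℕ∞) := by
  classical
  obtain ⟨hf0, hf4, hmult⟩ := hf
  have hma := hmult a a.2
  rw [hμ] at hma
  obtain ⟨A, B, C, hABC⟩ := exists_expansion_of_mult_two hM hf4 (ha ▸ hma)
  by_cases hgood : ∃ d₀, ∀ d, d ≠ d₀ → ¬(form 2 A (dir d).1 (dir d).2 = 0 ∧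
      form 3 B (dir d).1 (dir d).2 = 0 ∧ form 4 C (dir d).1 (dir d).2 = 0)
  · obtain ⟨d₀, hd₀⟩ := hgood
    refine (encard_rationalPoints_le ha hZ
      (E := fun d w => fiberEq (form 2 A (dir d).1 (dir d).2) (form 3 B (dir d).1 (dir d).2)
        (form 4 C (dir d).1 (dir d).2) w = 0)
      fun y hy d w hdw => eq_zero_of_mem_residualCurve ha hZ hμ hf4 hABC hdw hy).trans
      (Nat.cast_le.2 ?_)
    exact card_fiberEq_pairs_le _ _ _ d₀ hd₀
  · push Not at hgood
    -- The excepted direction `none` is arbitrary here: it yields a first full fibre, and excepting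
    -- that one yields a second.
    obtain ⟨d₁, -, h₁⟩ := hgood none
    obtain ⟨d₂, hne, h₂⟩ := hgood d₁
    obtain ⟨M', hM', he0, hframe⟩ := exists_frame_through (K := K) hM hne.symm
    have ha' : (a : ℙ K (Fin 3 → K)) = framePoint K M' hM' ![1, 0, 0] e0_ne_zero := by
      rw [ha]
      simp only [framePoint, he0]
    rw [ha'] at hPm
    obtain ⟨θ, ζ, hθ, hθ', hζ, -, hrne, hreq⟩ := exists_coordinates hm hm' hPm hr hr' hrm
    have hmr := hmult r hrZ
    rw [hμr] at hmr
    have hvanish : ∀ d, (form 2 A (dir d).1 (dir d).2 = 0 ∧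
        form 3 B (dir d).1 (dir d).2 = 0 ∧ form 4 C (dir d).1 (dir d).2 = 0) → ∀ z : K,
        MvPolynomial.aeval (frameMap K M ![z, algebraMap k K (dir d).1,
          algebraMap k K (dir d).2]) f = 0 := by
      rintro d ⟨h2, h3, h4⟩ z
      rw [hABC, ← map_form, ← map_form, ← map_form, h2, h3, h4]
      simp
    refine encard_le_of_two_fibers ha' hZ hμ hf4 hf0 hma hθ hθ' hζ
      (aeval_eq_zero_of_hasMultAtLeast_one hf4 hmr hrne hreq) ?_ ?_
    · intro z
      rw [hframe]
      simpa using hvanish d₁ h₁ z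
    · intro z
      rw [hframe]
      simpa using hvanish d₂ h₂ z

end Bound

/-! ### Linear forms, multiplicity and pullback -/

section LinearForms

open MvPolynomial

/-- The linear form with the given coefficients. -/
def linForm {R : Type*} [CommRing R] (c : Fin 3 → R) : MvPolynomial (Fin 3) R :=
  ∑ j, C (c j) * X j

theorem isHomogeneous_linForm {R : Type*} [CommRing R] (c : Fin 3 → R) :
    (linForm c).IsHomogeneous 1 :=
  IsHomogeneous.sum _ _ _ fun j _ => by
    simpa using (isHomogeneous_C (Fin 3) (c j)).mul (isHomogeneous_X R j)

variable {k : Type*} [Field k] {K : Type*} [Field K] [Algebra k K]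

theorem aeval_linForm (c : Fin 3 → k) (x : Fin 3 → K) :
    aeval x (linForm c) = ofBase c ⬝ᵥ x := by
  simp [linForm, dotProduct, ofBase]

theorem map_linForm (c : Fin 3 → k) : map (algebraMap k K) (linForm c) = linForm (ofBase c) := by
  simp [linForm, ofBase]

/-- Modulo the ideal each variable equals its value at x, hence so does every polynomial. -/
theorem sub_C_eval_mem_span {σ : Type*} (x : σ → K) (f : MvPolynomial σ K) :
    f - C (eval x f) ∈ Ideal.span (Set.range fun i => (X i - C (x i) : MvPolynomial σ K)) := by
  rw [← Ideal.Quotient.eq]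
  have : Ideal.Quotient.mk (Ideal.span (Set.range fun i => (X i - C (x i) : MvPolynomial σ K))) =
      (Ideal.Quotient.mk (Ideal.span (Set.range fun i => (X i - C (x i) : MvPolynomial σ K)))).comp
        (C.comp (eval x)) := by
    apply MvPolynomial.ringHom_ext
    · intro r
      simp
    · intro i
      simp only [RingHom.comp_apply, eval_X]
      exact Ideal.Quotient.eq.2 (Ideal.subset_span ⟨i, rfl⟩)
  exact congrArg (fun φ => φ f) this

theorem mem_span_of_eval_eq_zero {σ : Type*} {x : σ → K} {f : MvPolynomial σ K}
    (h : eval x f = 0) :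
    f ∈ Ideal.span (Set.range fun i => (X i - C (x i) : MvPolynomial σ K)) := by
  simpa [h] using sub_C_eval_mem_span x f

/-- The α term drops out because the line passes through a. Two such lines supply the factor β²
removed with 2E. -/
theorem pullback_linForm {a : ℙ K (Fin 3 → K)} {c : Fin 3 → K} (h : c ⬝ᵥ a.rep = 0) :
    pullback a (linForm c) = X (Sum.inl 1) * ∑ j, C (c j) * X (Sum.inr j) := by
  have h1 : X (Sum.inl 0) * C (c ⬝ᵥ a.rep) = (0 : MvPolynomial (Fin 2 ⊕ Fin 3) K) := by
    rw [h, map_zero, mul_zero]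
  simp only [dotProduct, Fin.sum_univ_three, map_add, map_mul] at h1
  simp only [pullback, linForm, Fin.sum_univ_three, map_add, map_mul, aeval_X, algHom_C,
    algebraMap_eq]
  linear_combination h1

theorem isHomogeneous_conic (c a₁ a₂ b₀ b₁ b₂ : k) {L₀ L₁ L₂ : MvPolynomial (Fin 3) k}
    (h₀ : L₀.IsHomogeneous 1) (h₁ : L₁.IsHomogeneous 1) (h₂ : L₂.IsHomogeneous 1) :
    (conic (C c) (C a₁) (C a₂) (C b₀) (C b₁) (C b₂) L₀ L₁ L₂).IsHomogeneous 2 := by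
  have hC : ∀ (r : k) {n : ℕ} {g : MvPolynomial (Fin 3) k}, g.IsHomogeneous n →
      (C r * g).IsHomogeneous n := fun r n g hg => by
    simpa using (isHomogeneous_C (Fin 3) r).mul hg
  refine ((hC c (h₀.pow 2)).add (h₀.mul ((hC a₁ h₁).add (hC a₂ h₂)))).add
    (((hC b₀ (h₁.pow 2)).add ?_).add (hC b₂ (h₂.pow 2)))
  exact (hC b₁ h₁).mul h₂

theorem aeval_conic (c a₁ a₂ b₀ b₁ b₂ : k) (L₀ L₁ L₂ : MvPolynomial (Fin 3) k) (x : Fin 3 → K) :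
    aeval x (conic (C c) (C a₁) (C a₂) (C b₀) (C b₁) (C b₂) L₀ L₁ L₂) =
      conic (algebraMap k K c) (algebraMap k K a₁) (algebraMap k K a₂) (algebraMap k K b₀)
        (algebraMap k K b₁) (algebraMap k K b₂) (aeval x L₀) (aeval x L₁) (aeval x L₂) := by
  simp only [conic, map_add, map_mul, map_pow, algHom_C]

end LinearForms

/-! ### A curve reaching the bound -/

section Existence

variable {k : Type*} [Field k] {K : Type*} [Field K] [Algebra k K]
  {Z : Set (ℙ K (Fin 3 → K))} {μ : ℙ K (Fin 3 → K) → ℕ} {a : Z}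

open MvPolynomial in
theorem mem_residualCurve_none {M : Matrix (Fin 3) (Fin 3) k} {hM : M.det ≠ 0}
    (ha : (a : ℙ K (Fin 3 → K)) = framePoint K M hM ![1, 0, 0] e0_ne_zero) (hμ : μ a = 2)
    {c c' : Fin 3 → k} {h : MvPolynomial (Fin 3) k}
    (hc : (ofBase c : Fin 3 → K) ⬝ᵥ (a : ℙ K (Fin 3 → K)).rep = 0)
    (hc' : (ofBase c' : Fin 3 → K) ⬝ᵥ (a : ℙ K (Fin 3 → K)).rep = 0)
    {y : Blowup Z} {d : Option k} (hy : y.HasParam M hM a d none)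
    (hd : c ⬝ᵥ M.mulVec (dirVec d) = 0 ∨ c' ⬝ᵥ M.mulVec (dirVec d) = 0) :
    y ∈ residualCurve Z μ (map (algebraMap k K) (linForm c * linForm c' * h)) := by
  have hya : y.pt = a := by
    rw [hy.1, ha]
    rfl
  let v : Fin 3 → K := ofBase (M.mulVec (dirVec d))
  refine Or.inr ⟨a, hya, (∑ j, C (ofBase c j) * X (Sum.inr j)) *
    (∑ j, C (ofBase c' j) * X (Sum.inr j)) * pullback a (map (algebraMap k K) h), ?_,
    Sum.elim ![1, 0] v, ⟨?_, ?_, ?_⟩, ?_⟩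
  · have hmul : ∀ p q : MvPolynomial (Fin 3) K, pullback (a : ℙ K (Fin 3 → K)) (p * q) =
        pullback (a : ℙ K (Fin 3 → K)) p * pullback (a : ℙ K (Fin 3 → K)) q :=
      fun p q => map_mul _ p q
    rw [hμ, map_mul, map_mul, map_linForm, map_linForm, hmul, hmul, pullback_linForm hc,
      pullback_linForm hc']
    ring
  · obtain ⟨l, hl0, hl⟩ := exists_framePoint_rep (K := K) hM (e0_ne_zero (k := k))
    rw [LinearIndependent.pair_iff]
    intro s t hst
    change s • (a : ℙ K (Fin 3 → K)).rep + t • v = 0 at hst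
    rw [ha, hl] at hst
    simp only [v, ← frameMap_ofBase, ← map_smul, ← map_add] at hst
    rw [← map_zero (frameMap K M)] at hst
    have hst := frameMap_injective hM hst
    have h0 := congrFun hst 0
    have h1 := congrFun hst 1
    have h2 := congrFun hst 2
    simp only [ofBase, dirVec, Pi.add_apply, Pi.smul_apply, Matrix.cons_val, smul_eq_mul, map_one,
      map_zero, mul_one, mul_zero, add_zero, zero_add, Pi.zero_apply, mul_eq_zero, hl0, or_false,
      map_eq_zero] at h0 h1 h2
    refine ⟨h0, ?_⟩
    rcases dir_ne_zero d with hd | hd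
    · exact h1.resolve_right hd
    · exact h2.resolve_right hd
  · have h2 := hy.2
    rw [framePoint, ← Projectivization.mk_rep (y.line a), Projectivization.orthogonal_mk] at h2
    exact h2
  · have h0 : ((Sum.elim ![1, 0] v : Fin 2 ⊕ Fin 3 → K) (Sum.inl 0) • (a : ℙ K (Fin 3 → K)).rep +
        (Sum.elim ![1, 0] v : Fin 2 ⊕ Fin 3 → K) (Sum.inl 1) •
          fun i => (Sum.elim ![1, 0] v : Fin 2 ⊕ Fin 3 → K) (Sum.inr i)) =
        (a : ℙ K (Fin 3 → K)).rep := by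
      simp
    refine ⟨ne_of_eq_of_ne h0 (a : ℙ K (Fin 3 → K)).rep_nonzero, ?_⟩
    simp only [h0, Projectivization.mk_rep, hya]
  · have heval : ∀ c : Fin 3 → k, eval (Sum.elim ![1, 0] v : Fin 2 ⊕ Fin 3 → K)
        (∑ j, C (ofBase c j) * X (Sum.inr j)) =
        algebraMap k K (c ⬝ᵥ M.mulVec (dirVec d)) := by
      intro c
      simp [dotProduct, v, ofBase]
    rw [map_mul, map_mul, heval, heval]
    rcases hd with hd | hd <;> simp [hd]

variable [Fintype k]

theorem mem_residualCurve_some {M : Matrix (Fin 3) (Fin 3) k} {hM : M.det ≠ 0}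
    (ha : (a : ℙ K (Fin 3 → K)) = framePoint K M hM ![1, 0, 0] e0_ne_zero)
    (hZ : ∀ b ∈ Z, b ≠ a → frobPlane k b ≠ b) {n : ℕ} {f : MvPolynomial (Fin 3) k}
    (hf : f.IsHomogeneous n) {y : Blowup Z} {d : Option k} {z : k}
    (hy : y.HasParam M hM a d (some z))
    (h : MvPolynomial.aeval (frameMap K M ![algebraMap k K z, algebraMap k K (dir d).1,
      algebraMap k K (dir d).2]) f = 0) :
    y ∈ residualCurve Z μ (MvPolynomial.map (algebraMap k K) f) := by
  refine Or.inl ?_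
  rw [hy.1]
  refine ⟨framePoint_ptVec_notMem ha hZ d z, ?_⟩
  rw [eval_framePoint_rep_eq_zero_iff hM _ hf]
  simpa only [ptVec, Option.elim, ofBase_vec3] using h

open MvPolynomial in
/-- The union of two lines through the double point and a conic that they miss reaches the
bound. -/
theorem exists_le_encard [Infinite K] {M : Matrix (Fin 3) (Fin 3) k} {hM : M.det ≠ 0}
    (hq : 3 ≤ Fintype.card k)
    (ha : (a : ℙ K (Fin 3 → K)) = framePoint K M hM ![1, 0, 0] e0_ne_zero)
    (hμ : μ a = 2) {r : ℙ K (Fin 3 → K)}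
    (hZ : ∀ b ∈ Z, b ≠ a → frobPlane k b ≠ b)
    (hZr : ∀ b ∈ Z, b ≠ a → μ b = 1 ∧ ∃ i : ℕ, b = (frobPlane k)^[i] r)
    {θ ζ : K} (hθ : frob k K θ ≠ θ)
    (hθ' : frob k K (frob k K θ) = θ) (hζ : frob k K (frob k K ζ) ≠ ζ)
    (hζ' : frob k K (frob k K (frob k K (frob k K ζ))) = ζ)
    (hrne : frameMap K M ![ζ, θ, 1] ≠ 0) (hreq : r = Projectivization.mk K _ hrne) :
    ∃ f ∈ planeSystem k 4 Z μ, ((3 * Fintype.card k + 3 : ℕ) : ℕ∞) ≤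
      (rationalPoints k (residualCurve Z μ (map (algebraMap k K) f))).encard := by
  classical
  obtain ⟨a₁, a₂, b₀, b₁, b₂, d₁, d₂, hd, hconic, hd₁, hd₂, hcard⟩ :=
    exists_conic_through hq hθ hθ' hζ hζ'
  let L : Fin 3 → MvPolynomial (Fin 3) k := fun i => linForm (M⁻¹ i)
  have hMinv : (M.map (algebraMap k K))⁻¹ = M⁻¹.map (algebraMap k K) := by
    apply Matrix.inv_eq_left_inv
    rw [← Matrix.map_mul, Matrix.nonsing_inv_mul _ hM.isUnit]
    simp
  have hL : ∀ (x : Fin 3 → K) i, (ofBase (M⁻¹ i) : Fin 3 → K) ⬝ᵥ frameMap K M x = x i := by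
    intro x i
    have h1 : (M⁻¹.map (algebraMap k K)).mulVec (frameMap K M x) = x := by
      rw [← hMinv, frameMap, Matrix.mulVecLin_apply, Matrix.mulVec_mulVec,
        Matrix.nonsing_inv_mul _ (det_map_ne_zero hM).isUnit, Matrix.one_mulVec]
    exact congrFun h1 i
  -- The rows of M⁻¹ are the coordinate forms of the frame, so this is the equation of the line d
  -- through P.
  let c : Option k → Fin 3 → k := fun d => (dir d).2 • M⁻¹ 1 - (dir d).1 • M⁻¹ 2
  have hc : ∀ d (x : Fin 3 → K), (ofBase (c d) : Fin 3 → K) ⬝ᵥ frameMap K M x =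
      algebraMap k K (dir d).2 * x 1 - algebraMap k K (dir d).1 * x 2 := by
    intro d x
    rw [← hL x 1, ← hL x 2]
    simp only [c, ofBase, dotProduct, Fin.sum_univ_three, Pi.sub_apply, Pi.smul_apply, smul_eq_mul,
      map_sub, map_mul]
    ring
  let h := conic (C 1) (C a₁) (C a₂) (C b₀) (C b₁) (C b₂) (L 0) (L 1) (L 2)
  have hh : h.IsHomogeneous 2 := isHomogeneous_conic _ _ _ _ _ _ (isHomogeneous_linForm _)
    (isHomogeneous_linForm _) (isHomogeneous_linForm _)
  have heval : ∀ z s t : K, aeval (frameMap K M ![z, s, t]) h = conic 1 (algebraMap k K a₁)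
      (algebraMap k K a₂) (algebraMap k K b₀) (algebraMap k K b₁) (algebraMap k K b₂) z s t := by
    intro z s t
    simp only [h, L]
    rw [aeval_conic, aeval_linForm, aeval_linForm, aeval_linForm, hL, hL, hL, map_one]
    rfl
  let f := linForm (c d₁) * linForm (c d₂) * h
  have hf4 : f.IsHomogeneous 4 :=
    ((isHomogeneous_linForm _).mul (isHomogeneous_linForm _)).mul hh
  have hfeval : ∀ z s t : K, aeval (frameMap K M ![z, s, t]) f =
      (algebraMap k K (dir d₁).2 * s - algebraMap k K (dir d₁).1 * t) *
      (algebraMap k K (dir d₂).2 * s - algebraMap k K (dir d₂).1 * t) *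
      conic 1 (algebraMap k K a₁) (algebraMap k K a₂) (algebraMap k K b₀) (algebraMap k K b₁)
        (algebraMap k K b₂) z s t := by
    intro z s t
    simp only [f]
    rw [map_mul, map_mul, heval, aeval_linForm, aeval_linForm, hc, hc]
    rfl
  obtain ⟨l, hl0, hl⟩ := exists_framePoint_rep (K := K) hM (e0_ne_zero (k := k))
  rw [← ha] at hl
  have hca : ∀ d, (ofBase (c d) : Fin 3 → K) ⬝ᵥ (a : ℙ K (Fin 3 → K)).rep = 0 := by
    intro d
    rw [hl, dotProduct_smul, hc]
    simp [ofBase]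
  have hcd : ∀ d, c d ⬝ᵥ M.mulVec (dirVec d) = 0 := by
    intro d
    apply (algebraMap k K).injective
    have h1 := hc d (ofBase (dirVec d))
    rw [frameMap_ofBase] at h1
    rw [map_zero]
    simp only [dotProduct, map_sum, map_mul]
    refine h1.trans ?_
    simp only [dirVec, ofBase, Matrix.cons_val]
    ring
  -- The conic has coefficients in k, so with r it contains all its conjugates.
  have hfr : ∀ i : ℕ, ∃ (v : Fin 3 → K) (hv : v ≠ 0),
      (frobPlane k)^[i] r = Projectivization.mk K v hv ∧ aeval v h = 0 := by
    intro i
    induction i with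
    | zero =>
      refine ⟨_, hrne, hreq, ?_⟩
      rw [heval, hconic]
    | succ i ih =>
      obtain ⟨v, hv, hiv, hhv⟩ := ih
      refine ⟨frobVec k K v, (map_ne_zero_iff _ (frobVec_injective k)).2 hv, ?_, ?_⟩
      · rw [Function.iterate_succ_apply', hiv, frobPlane_mk]
      · have h1 := congrArg (FiniteField.frobeniusAlgHom k K) hhv
        rw [map_zero, comp_aeval_apply] at h1
        exact h1
  have hfmem : f ∈ planeSystem k 4 Z μ := by
    refine ⟨?_, hf4, ?_⟩
    · intro hf0
      -- At (0, θ, 1) no factor vanishes: θ lies on no rational direction, and the conic has no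
      -- point above θ with z fixed by φ².
      have h1 := hfeval 0 θ 1
      have h2 := conic_ne_zero_of_frob_frob_eq 1 a₁ a₂ b₀ b₁ b₂ one_ne_zero hθ' hζ
        (by rwa [map_one]) 0 (by simp)
      have h3 : ∀ d : Option k,
          algebraMap k K (dir d).2 * θ - algebraMap k K (dir d).1 * 1 ≠ 0 := by
        intro d h4
        obtain ⟨h5, h6⟩ := eq_zero_of_mul_add_eq_zero hθ (a := (dir d).2) (b := -(dir d).1) (by
          rw [map_neg]
          linear_combination h4)
        rcases dir_ne_zero d with h7 | h7
        · exact h7 (neg_eq_zero.1 h6)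
        · exact h7 h5
      rw [hf0, map_zero] at h1
      rw [map_one] at h2
      exact mul_ne_zero (mul_ne_zero (h3 d₁) (h3 d₂)) h2 h1.symm
    · intro b hb
      by_cases hba : b = a
      · subst hba
        rw [hμ, HasMultAtLeast, pow_two]
        simp only [f]
        rw [map_mul, map_mul]
        refine Ideal.mul_mem_right _ _ (Ideal.mul_mem_mul ?_ ?_) <;>
        · apply mem_span_of_eval_eq_zero
          rw [eval_map_eq_aeval, aeval_linForm, hca]
      · obtain ⟨hμb, i, hi⟩ := hZr b hb hba
        rw [hμb, HasMultAtLeast, pow_one]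
        simp only [f]
        rw [map_mul]
        refine Ideal.mul_mem_left _ _ (mem_span_of_eval_eq_zero ?_)
        obtain ⟨v, hv, hiv, hhv⟩ := hfr i
        obtain ⟨e, he⟩ := Projectivization.exists_smul_eq_mk_rep K v hv
        rw [hi, hiv, ← he, show e • v = fun i => (e : K) * v i from rfl,
          eval_mul_of_isHomogeneous (hh.map (algebraMap k K)), eval_map_eq_aeval, hhv, mul_zero]
  refine ⟨f, hfmem, ?_⟩
  have hex : ∀ p : Option k × Option k, ∃ y : Blowup Z, y.IsRational k ∧
      y.HasParam M hM a p.1 p.2 := fun p => Blowup.exists_hasParam ha hZ p.1 p.2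
  choose y hyr hyp using hex
  let S₁ : Finset (Option k × Option k) := {d₁, d₂} ×ˢ Finset.univ
  let S₂ : Finset (Option k × k) := Finset.univ.filter fun p =>
      conic 1 a₁ a₂ b₀ b₁ b₂ p.2 (dir p.1).1 (dir p.1).2 = 0
  let S : Finset (Option k × Option k) := S₁ ∪ S₂.image fun p => (p.1, some p.2)
  have hS₁ : S₁.card = 2 * (Fintype.card k + 1) := by
    rw [Finset.card_product, Finset.card_pair hd]
    simp
  have hS₂ : S₂.card = Fintype.card k + 1 := by
    rwa [Nat.card_eq_fintype_card, Fintype.card_subtype] at hcard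
  have hS : S.card = 3 * Fintype.card k + 3 := by
    rw [Finset.card_union_of_disjoint, Finset.card_image_of_injective, hS₁, hS₂]
    · ring
    · rintro ⟨d, z⟩ ⟨d', z'⟩ h
      simpa using h
    · rw [Finset.disjoint_left]
      rintro ⟨d, w⟩ h1 h2
      obtain ⟨⟨d', z⟩, h3, h4⟩ := Finset.mem_image.1 h2
      simp only [Prod.mk.injEq] at h4
      obtain ⟨rfl, rfl⟩ := h4
      simp only [S₁, S₂, Finset.mem_product, Finset.mem_insert, Finset.mem_singleton,
        Finset.mem_univ, and_true, Finset.mem_filter, true_and] at h1 h3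
      rcases h1 with rfl | rfl
      · exact hd₁ z h3
      · exact hd₂ z h3
  rw [← hS, ← Set.encard_coe_eq_coe_finsetCard]
  refine Set.encard_le_encard_of_injOn (f := y) ?_ ?_
  · rintro ⟨d, w⟩ hp
    refine ⟨?_, hyr _⟩
    have hyp := hyp (d, w)
    simp only at hyp
    simp only [S, Finset.coe_union, Set.mem_union, Finset.mem_coe] at hp
    rcases hp with hp | hp
    · have hdd : d = d₁ ∨ d = d₂ := by simpa [S₁] using hp
      rcases w with _ | z
      · refine mem_residualCurve_none ha hμ (hca d₁) (hca d₂) hyp ?_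
        rcases hdd with rfl | rfl
        · exact Or.inl (hcd _)
        · exact Or.inr (hcd _)
      · refine mem_residualCurve_some ha hZ hf4 hyp ?_
        rw [hfeval]
        rcases hdd with rfl | rfl <;> ring
    · obtain ⟨⟨d', z⟩, h3, h4⟩ := Finset.mem_image.1 hp
      simp only [Prod.mk.injEq] at h4
      obtain ⟨rfl, rfl⟩ := h4
      simp only [S₂, Finset.mem_filter, Finset.mem_univ, true_and] at h3
      refine mem_residualCurve_some ha hZ hf4 hyp ?_
      have h5 := congrArg (algebraMap k K) h3
      have h6 : conic 1 (algebraMap k K a₁) (algebraMap k K a₂) (algebraMap k K b₀)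
          (algebraMap k K b₁) (algebraMap k K b₂) (algebraMap k K z) (algebraMap k K (dir d').1)
          (algebraMap k K (dir d').2) = 0 := by
        simp only [conic, map_add, map_mul, map_pow, map_one, map_zero] at h5 ⊢
        exact h5
      rw [hfeval, h6, mul_zero]
  · intro p _ p' _ hpp
    obtain ⟨h1, h2⟩ := (hyr p).hasParam_injective ha (hyp p) (hpp ▸ hyp p')
    exact Prod.ext h1 h2

end Existence

end PlaneBlowup

end

/-! ### The theorem -/

theorem mainTheorem7 {k : Type*} [Field k] [Fintype k] {K : Type*} [Field K] [Algebra k K]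
    [IsAlgClosure k K]
    (l P r : ℙ K (Fin 3 → K))
    (hl : Function.minimalPeriod (PlaneBlowup.frobPlane k) l = 2)
    (hP : PlaneBlowup.frobPlane k P = P)
    (hPl : Projectivization.orthogonal P l)
    (hPl' : Projectivization.orthogonal P (PlaneBlowup.frobPlane k l))
    (hr : Function.minimalPeriod (PlaneBlowup.frobPlane k) r = 4)
    (hrD : Projectivization.orthogonal r l ∨
      Projectivization.orthogonal r (PlaneBlowup.frobPlane k l)) :
    (∀ C ∈ PlaneBlowup.blowupSystem k 4 (PlaneBlowup.centers k P r) (PlaneBlowup.mults P),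
      (PlaneBlowup.rationalPoints k C).encard ≤ ((3 * Fintype.card k + 3 : ℕ) : ℕ∞)) ∧
    (3 ≤ Fintype.card k →
      ∃ C ∈ PlaneBlowup.blowupSystem k 4 (PlaneBlowup.centers k P r) (PlaneBlowup.mults P),
        (PlaneBlowup.rationalPoints k C).encard = ((3 * Fintype.card k + 3 : ℕ) : ℕ∞)) := by
  open PlaneBlowup in
  have := IsAlgClosure.isAlgClosed k (K := K)
  have : Infinite K := IsAlgClosed.instInfinite
  have hl1 : frobPlane k l ≠ l := fun h => by
    have := Function.minimalPeriod_eq_one_iff_isFixedPt.2 h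
    omega
  have hl2 : frobPlane k (frobPlane k l) = l := by
    have := Function.iterate_minimalPeriod (f := frobPlane k) (x := l)
    rwa [hl] at this
  have hr2 : frobPlane k (frobPlane k r) ≠ r := fun h => by
    have := Function.IsPeriodicPt.minimalPeriod_le (f := frobPlane k) (x := r) (n := 2)
      (by norm_num) h
    omega
  have hr4 : frobPlane k (frobPlane k (frobPlane k (frobPlane k r))) = r := by
    have := Function.iterate_minimalPeriod (f := frobPlane k) (x := r)
    rwa [hr] at this
  obtain ⟨m, hm, hm', hPm, hrm⟩ : ∃ m : ℙ K (Fin 3 → K), frobPlane k m ≠ m ∧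
      frobPlane k (frobPlane k m) = m ∧ P.orthogonal m ∧ r.orthogonal m := by
    rcases hrD with h | h
    · exact ⟨l, hl1, hl2, hPl, h⟩
    · exact ⟨frobPlane k l, fun h' => hl1 (frobPlane_injective (k := k) h'), by rw [hl2], hPl', h⟩
  -- Frobenius is injective, so a rational conjugate would make r itself rational.
  have hiter : ∀ i : ℕ, frobPlane k ((frobPlane k)^[i] r) ≠ (frobPlane k)^[i] r := by
    intro i h
    rw [← Function.iterate_succ_apply' (frobPlane k), Function.iterate_succ_apply] at h
    have h1 := (frobPlane_injective (k := k)).iterate i h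
    exact hr2 (by rw [h1, h1])
  have hZr : ∀ b ∈ centers k P r, b ≠ P → mults P b = 1 ∧ ∃ i : ℕ, b = (frobPlane k)^[i] r := by
    rintro b (rfl | ⟨i, rfl⟩) hb
    · exact absurd rfl hb
    · exact ⟨by simp [mults, hb], i, rfl⟩
  have hZ : ∀ b ∈ centers k P r, b ≠ P → frobPlane k b ≠ b := by
    intro b hb hbP
    obtain ⟨-, i, rfl⟩ := hZr b hb hbP
    exact hiter i
  have hrP : r ≠ P := by
    rintro rfl
    exact hr2 (by rw [hP, hP])
  have hrZ : r ∈ centers k P r := Or.inr ⟨0, rfl⟩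
  let a : centers k P r := ⟨P, Or.inl rfl⟩
  have hμ : mults P (a : ℙ K (Fin 3 → K)) = 2 := by simp [mults, a]
  obtain ⟨v, hv, hPv⟩ := exists_mk_ofBase hP
  obtain ⟨M, hM, hMv⟩ := exists_frame hv
  have ha : (a : ℙ K (Fin 3 → K)) = framePoint K M hM ![1, 0, 0] e0_ne_zero := by
    simp only [a, framePoint, hMv]
    exact hPv
  have hupper : ∀ f ∈ planeSystem k 4 (centers k P r) (mults P),
      (rationalPoints k (residualCurve (centers k P r) (mults P)
        (MvPolynomial.map (algebraMap k K) f))).encard ≤ ((3 * Fintype.card k + 3 : ℕ) : ℕ∞) :=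
    fun f hf => encard_rationalPoints_residualCurve_le (a := a) ha hZ hμ hrZ (hZr r hrZ hrP).1
      hm hm' hPm hr2 hr4 hrm hf
  refine ⟨?_, fun hq => ?_⟩
  · rintro C ⟨f, hf, rfl⟩
    exact hupper f hf
  · obtain ⟨θ, ζ, hθ, hθ', hζ, hζ', hrne, hreq⟩ :=
      exists_coordinates (hM := hM) hm hm' (ha ▸ hPm) hr2 hr4 hrm
    obtain ⟨f, hf, hle⟩ := exists_le_encard (a := a) hq ha hμ hZ hZr hθ hθ' hζ hζ' hrne hreq
    exact ⟨_, ⟨f, hf, rfl⟩, le_antisymm (hupper f hf) hle⟩
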